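/- **Conventions.** For $0<q\le\infty$ put $1/\infty=0$. For a measurable $f:[0,1]\to\mathbb C$ let $f^*(t)=\inf\{s\ge 0: |\{x\in[0,1]:|f(x)|>s\}|\le t\}$, and for a family $c=\{c_n\}_{n\in I}$ of complex numbers let $c_k^*=\inf\{s\ge0:\#\{n:|c_n|>s\}\le k-1\}$, $k=1,2,\dots$ ($\inf\emptyset=\infty$). For $0<p,q\le\infty$ and $\beta\in\mathbb R$ let $L_{p,q}(\log L)_\beta$ be the space of (classes of) measurable functions $f$ on $[0,1]$ with $$\|f\|_{L_{p,q}(\log L)_\beta}:=\big\|t^{1/p-1/q}(1+|\log t|)^\beta f^*(t)\big\|_{L_q(0,1)}<\infty,$$ and let $l_{p,q}(\log l)_\beta$ be the space of families $c$ with $$\|c\|_{l_{p,q}(\log l)_\beta}:=\big\|\{k^{1/p-1/q}(1+\log k)^\beta c_k^*\}_{k\ge1}\big\|_{l_q}<\infty.$$ The intersection of two such spaces carries the maximum of the two quasi-norms. Let $I$ be a countably infinite index set (for instance $\mathbb N$ or $\mathbb Z$), let $\{\varphi_n\}_{n\in I}$ be an orthonormal system in $L_2[0,1]$ with $M:=\sup_n\|\varphi_n\|_{L_\infty}<\infty$,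 and let $\mathcal F^{-1}c:=\sum_{n\in I} c_n\varphi_n$ (unconditional convergence in $L_2$). **Corollary 4.2.** Let $0<q\le\infty$, $\alpha>-1/q$ and $\varepsilon>0$. There is a constant $C>0$, depending only on $q$, $\alpha$ and $\varepsilon$, such that for every such system and every $c\in l_{2,q}(\log l)_{\alpha+1/\min(q,2)}$ the series $\sum_n c_n\varphi_n$ converges unconditionally in $L_2$, its sum $\mathcal F^{-1}c$ belongs to $L_{2,q}(\log L)_{\alpha+1/\max(q,2)}\cap L_{2,\max(q,2)}(\log L)_{\alpha+1/q}$, and $$\big\|\mathcal F^{-1}c\big\|_{L_{2,q}(\log L)_{\alpha+1/\max(q,2)}\cap L_{2,\max(q,2)}(\log L)_{\alpha+1/q}}\le C\,\min\!\big(M,(1+\log M)^{|\alpha+\varepsilon+1/q|}\big)\,\|c\|_{l_{2,q}(\log l)_{\alpha+1/\min(q,2)}}.$$ In particular, if $\alpha>-1/2$ and $\varepsilon>0$, there is a constant $C>0$, depending only on $\alpha$ and $\varepsilon$, such that for every such system and every $c\in l_{2,2}(\log l)_{\alpha+1/2}$ the series converges unconditionally in $L_2$, $\mathcal F^{-1}c\in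 L_{2,2}(\log L)_{\alpha+1/2}$, and $$\big\|\mathcal F^{-1}c\big\|_{L_{2,2}(\log L)_{\alpha+1/2}}\le C\,\min\!\big(M,(1+\log M)^{|\alpha+\varepsilon+1/2|}\big)\,\|c\|_{l_{2,2}(\log l)_{\alpha+1/2}}.$$ -/

import Mathlib

open MeasureTheory Set
open scoped ENNReal

noncomputable section

/-- Lebesgue measure on the interval `[0, 1]`. -/
abbrev volI : Measure ℝ := volume.restrict (Icc 0 1)

/-- The real number `1 / q` attached to `0 < q ≤ ∞`, with `1 / ∞ = 0`. -/
def recip (q : ℝ≥0∞) : ℝ := (q⁻¹).toReal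

/-- The non-increasing rearrangement `f^*(t) = inf {s : |{x ∈ [0,1] : |f x| > s}| ≤ t}` of a
function on `[0, 1]`. -/
def funRearr (f : ℝ → ℂ) (t : ℝ) : ℝ≥0∞ :=
  sInf {s : ℝ≥0∞ | volI {x | s < ‖f x‖ₑ} ≤ ENNReal.ofReal t}

/-- The non-increasing rearrangement of a family `c` of complex numbers. The numbering starts at
zero: `seqRearr c k` is the `(k + 1)`-st term `c^*_{k+1} = inf {s : #{n : |c n| > s} ≤ k}`. -/
def seqRearr {ι : Type*} (c : ι → ℂ) (k : ℕ) : ℝ≥0∞ :=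
  sInf {s : ℝ≥0∞ | {n | s < ‖c n‖ₑ}.encard ≤ k}

/-- The quasi-norm of the Lorentz–Zygmund function space `L_{p,q}(log L)_β` (`0 < p, q ≤ ∞`):
the `L_q(0,1)` quasi-norm of `t^{1/p-1/q} (1 + |log t|)^β f^*(t)`. -/
def funLZNorm (p q : ℝ≥0∞) (β : ℝ) (f : ℝ → ℂ) : ℝ≥0∞ :=
  eLpNorm (fun t : ℝ =>
      ENNReal.ofReal (t ^ (recip p - recip q) * (1 + |Real.log t|) ^ β) * funRearr f t)
    q (volume.restrict (Ioo 0 1))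

/-- The quasi-norm of the Lorentz–Zygmund sequence space `l_{p,q}(log l)_β` (`0 < p, q ≤ ∞`):
the `l_q` quasi-norm of `k^{1/p-1/q} (1 + log k)^β c^*_k`, `k = 1, 2, …` (here `k` is written
`k + 1` with `k : ℕ`; the `l_q` quasi-norm is the `L_q` one for the counting measure). -/
def seqLZNorm {ι : Type*} (p q : ℝ≥0∞) (β : ℝ) (c : ι → ℂ) : ℝ≥0∞ :=
  eLpNorm (fun k : ℕ =>
      ENNReal.ofReal (((k : ℝ) + 1) ^ (recip p - recip q) * (1 + Real.log ((k : ℝ) + 1)) ^ β)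
        * seqRearr c k)
    q Measure.count

/-- The Lorentz–Zygmund function space `L_{p,q}(log L)_β` on `[0, 1]`. -/
def funLZ (p q : ℝ≥0∞) (β : ℝ) : Set (ℝ → ℂ) :=
  {f | AEStronglyMeasurable f volI ∧ funLZNorm p q β f < ∞}

/-- The Lorentz–Zygmund sequence space `l_{p,q}(log l)_β` over the index set `ι`. -/
def seqLZ (ι : Type*) (p q : ℝ≥0∞) (β : ℝ) : Set (ι → ℂ) :=
  {c | seqLZNorm p q β c < ∞}

/-- The inverse Fourier map `{c_n} ↦ ∑ c_n φ_n`, the series being summed in `L_2`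
(this is only meaningful for `c` such that the series converges in `L_2`). -/
def invFourier {ι : Type*} (φ : ι → Lp ℂ 2 volI) (c : ι → ℂ) : Lp ℂ 2 volI :=
  ∑' n, c n • φ n

end

/-!
For `f = ∑ c_n φ_n` write `a_j = 2^{j/2} c^*_{2^j}` and `f_j = 2^{-j/2} f^*(2^{-j})`. In terms of
these dyadic sequences both Lorentz–Zygmund norms are `l_q` norms with a weight `(j + 1)^b`, which
is comparable to a constant on each block `2^l ≤ j + 1 < 2^{l+1}`. Comparing `l_q` with `l_2` inside
the blocks costs precisely the shifts `1/min(q,2)` and `1/max(q,2)` of the logarithmic exponents, so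
it suffices to bound `‖2^{δl} F_l‖_q` by `‖2^{δl} A_l‖_q`, where `F_l`, `A_l` are the `l_2` norms
of `f_j`, `a_j` over the `l`-th block and `δ = α + 1/q > 0`.

The terms with the `2^J` largest coefficients contribute at most `M 2^{J/2} ‖a‖_2` in `L_∞`, and the
others at most the `l_2` tail of `a` beyond `J` in `L_2`. Taking for `J` about half of `j` gives
`F_l ≲ T_{l-1} + min(1, M 2^{-2^l/4}) T_0` for the `l_2` tails `T_l` of `A`. Hardy's inequality
controls the first term; in the second, `min(1, M 2^{-2^l/4})` is negligible once `2^l` exceeds a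
multiple of `1 + log M`, whence the factor `(1 + log M)^δ`.
-/

section CountingMeasure

variable {X ι : Type*} [MeasurableSpace X] [MeasurableSpace ι]

theorem eLpNorm_le_const_mul_of_discrete [DiscreteMeasurableSpace X] {μ : Measure X}
    {x y : X → ℝ≥0∞} {c : ℝ≥0∞} (q : ℝ≥0∞) (h : ∀ i, x i ≤ c * y i) :
    eLpNorm x q μ ≤ c * eLpNorm y q μ :=
  eLpNorm_le_mul_eLpNorm_of_ae_le_mul'' q Measurable.of_discrete.aestronglyMeasurable
    (.of_forall h)

theorem eLpNorm_restrict_le_const_mul_of_discrete [DiscreteMeasurableSpace X] {μ : Measure X}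
    {S : Set X} {x y : X → ℝ≥0∞} {c : ℝ≥0∞} (q : ℝ≥0∞) (h : ∀ i ∈ S, x i ≤ c * y i) :
    eLpNorm x q (μ.restrict S) ≤ c * eLpNorm y q (μ.restrict S) :=
  eLpNorm_le_mul_eLpNorm_of_ae_le_mul'' q Measurable.of_discrete.aestronglyMeasurable
    (ae_restrict_of_forall_mem .of_discrete h)

theorem eLpNorm_count_rpow_toReal [MeasurableSingletonClass X] {q : ℝ≥0∞} (hq : q ≠ 0)
    (hq' : q ≠ ∞) (x : X → ℝ≥0∞) :
    eLpNorm x q Measure.count ^ q.toReal = ∑' i, ‖x i‖ₑ ^ q.toReal := by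
  rw [eLpNorm_eq_lintegral_rpow_enorm_toReal hq hq', lintegral_count, one_div,
    ENNReal.rpow_inv_rpow (ENNReal.toReal_pos hq hq').ne']

theorem eLpNorm_restrict_iUnion [Countable ι] [MeasurableSingletonClass ι] {μ : Measure X}
    {S : ι → Set X} (hS : ∀ j, MeasurableSet (S j)) (hd : Pairwise (Function.onFun Disjoint S))
    (x : X → ℝ≥0∞) (q : ℝ≥0∞) :
    eLpNorm x q (μ.restrict (⋃ j, S j)) =
      eLpNorm (fun j => eLpNorm x q (μ.restrict (S j))) q Measure.count := by
  rcases eq_or_ne q 0 with rfl | hq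
  · simp
  rcases eq_or_ne q ∞ with rfl | hq'
  · simp only [eLpNorm_exponent_top, eLpNormEssSup_count, enorm_eq_self]
    apply le_antisymm
    · refine essSup_le_of_ae_le _ ?_
      rw [Filter.EventuallyLE, ae_restrict_iUnion_iff]
      intro j
      filter_upwards [ae_le_eLpNormEssSup (f := x) (μ := μ.restrict (S j))] with t ht
      exact ht.trans (le_iSup (fun j => eLpNormEssSup x (μ.restrict (S j))) j)
    · exact iSup_le fun j =>
        eLpNormEssSup_mono_measure _ (Measure.absolutelyContinuous_of_le
          (Measure.restrict_mono (subset_iUnion S j) le_rfl))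
  · have hpos : 0 < q.toReal := ENNReal.toReal_pos hq hq'
    simp only [eLpNorm_eq_lintegral_rpow_enorm_toReal hq hq', lintegral_iUnion hS hd,
      lintegral_count, enorm_eq_self, one_div, ENNReal.rpow_inv_rpow hpos.ne']

theorem eLpNorm_count_comm {Y : Type*} [MeasurableSpace Y] [MeasurableSingletonClass X]
    [MeasurableSingletonClass Y] (x : X → Y → ℝ≥0∞) (q : ℝ≥0∞) :
    eLpNorm (fun i => eLpNorm (fun j => x i j) q Measure.count) q Measure.count =
      eLpNorm (fun j => eLpNorm (fun i => x i j) q Measure.count) q Measure.count := by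
  rcases eq_or_ne q 0 with rfl | hq
  · simp
  rcases eq_or_ne q ∞ with rfl | hq'
  · simpa only [eLpNorm_exponent_top, eLpNormEssSup_count, enorm_eq_self] using iSup_comm
  · have hpos : 0 < q.toReal := ENNReal.toReal_pos hq hq'
    simp only [eLpNorm_eq_lintegral_rpow_enorm_toReal hq hq', lintegral_count, enorm_eq_self,
      one_div, ENNReal.rpow_inv_rpow hpos.ne']
    rw [ENNReal.tsum_comm]

theorem eLpNorm_count_comp [DiscreteMeasurableSpace X] [DiscreteMeasurableSpace ι]
    {σ : X → ι} (hσ : Function.Injective σ) (x : ι → ℝ≥0∞) (q : ℝ≥0∞) :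
    eLpNorm (x ∘ σ) q Measure.count = eLpNorm x q (Measure.count.restrict (range σ)) := by
  have hσ' : MeasurableEmbedding σ := ⟨hσ, .of_discrete, fun _ _ => .of_discrete⟩
  have hmap : Measure.count.map σ = Measure.count.restrict (range σ) := by
    ext s hs
    rw [Measure.map_apply .of_discrete hs, Measure.restrict_apply hs,
      ← image_preimage_eq_inter_range, Measure.count_injective_image hσ]
  rw [← hmap, hσ'.eLpNorm_map_measure]

theorem eLpNorm_count_comp_le [DiscreteMeasurableSpace X] [DiscreteMeasurableSpace ι]
    {σ : X → ι} (hσ : Function.Injective σ) (x : ι → ℝ≥0∞) (q : ℝ≥0∞) :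
    eLpNorm (x ∘ σ) q Measure.count ≤ eLpNorm x q Measure.count := by
  rw [eLpNorm_count_comp hσ]
  exact eLpNorm_mono_measure _ Measure.restrict_le_self

theorem eLpNorm_count_le_of_exponent_le [MeasurableSingletonClass X] {p q : ℝ≥0∞} (hp : p ≠ 0)
    (hpq : p ≤ q) (x : X → ℝ≥0∞) :
    eLpNorm x q Measure.count ≤ eLpNorm x p Measure.count := by
  have hx (i) : x i ≤ eLpNorm x p Measure.count := by
    simpa only [enorm_eq_self] using enorm_le_eLpNorm_count x i hp
  rcases eq_or_ne q ∞ with rfl | hq'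
  · simpa only [eLpNorm_exponent_top, eLpNormEssSup_count, enorm_eq_self, iSup_le_iff] using hx
  have hq : q ≠ 0 := (hp.bot_lt.trans_le hpq).ne'
  have hp' : p ≠ ∞ := ne_top_of_le_ne_top hq' hpq
  have hp0 : 0 < p.toReal := ENNReal.toReal_pos hp hp'
  have hpq' : 0 ≤ q.toReal - p.toReal := sub_nonneg.2 (ENNReal.toReal_mono hq' hpq)
  rw [← ENNReal.rpow_le_rpow_iff (ENNReal.toReal_pos hq hq'), eLpNorm_count_rpow_toReal hq hq']
  have split (a : ℝ≥0∞) : a ^ q.toReal = a ^ (q.toReal - p.toReal) * a ^ p.toReal := by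
    rw [← ENNReal.rpow_add_of_nonneg _ _ hpq' hp0.le, sub_add_cancel]
  rw [split, eLpNorm_count_rpow_toReal hp hp', ← ENNReal.tsum_mul_left]
  refine ENNReal.tsum_le_tsum fun i => ?_
  rw [split]
  gcongr
  exact hx i

theorem eLpNorm_count_restrict_le_of_exponent_le [DiscreteMeasurableSpace X]
    {p q : ℝ≥0∞} (hp : p ≠ 0) (hpq : p ≤ q) (x : X → ℝ≥0∞) (S : Set X) :
    eLpNorm x q (Measure.count.restrict S) ≤ eLpNorm x p (Measure.count.restrict S) := by
  simp only [← eLpNorm_indicator_eq_eLpNorm_restrict (MeasurableSet.of_discrete (s := S))]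
  exact eLpNorm_count_le_of_exponent_le hp hpq _

theorem eLpNorm_count_restrict_le_mul [DiscreteMeasurableSpace X] {p q : ℝ≥0∞}
    (hq : q ≠ 0) (x : X → ℝ≥0∞) (S : Set X) :
    eLpNorm x p (Measure.count.restrict S) ≤
      Measure.count S ^ (recip p - recip (max p q)) * eLpNorm x q (Measure.count.restrict S) := by
  rcases le_total p q with h | h
  · rw [max_eq_right h, mul_comm]
    simpa [recip] using eLpNorm_le_eLpNorm_mul_rpow_measure_univ
      (μ := Measure.count.restrict S) (f := x) h Measurable.of_discrete.aestronglyMeasurable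
  · rw [max_eq_left h, sub_self, ENNReal.rpow_zero, one_mul]
    exact eLpNorm_count_restrict_le_of_exponent_le hq h x S

end CountingMeasure

section PowersOfTwo

theorem two_rpow_ne_top (b : ℝ) : (2 : ℝ≥0∞) ^ b ≠ ∞ :=
  ENNReal.rpow_ne_top_of_ne_zero two_ne_zero ENNReal.ofNat_ne_top

theorem two_rpow_add (a b : ℝ) : (2 : ℝ≥0∞) ^ (a + b) = 2 ^ a * 2 ^ b :=
  ENNReal.rpow_add _ _ two_ne_zero ENNReal.ofNat_ne_top

theorem two_rpow_mul_natCast (b : ℝ) (n : ℕ) : (2 : ℝ≥0∞) ^ (b * n) = (2 ^ b) ^ n := by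
  rw [ENNReal.rpow_mul, ENNReal.rpow_natCast]

theorem two_rpow_neg_lt_one {δ : ℝ} (hδ : 0 < δ) : (2 : ℝ≥0∞) ^ (-δ) < 1 :=
  ENNReal.rpow_lt_one_of_one_lt_of_neg ENNReal.one_lt_two (neg_lt_zero.2 hδ)

theorem ennreal_rpow_half_sq (x : ℝ≥0∞) : (x ^ (1 / 2 : ℝ)) ^ 2 = x := by
  rw [← ENNReal.rpow_natCast, ← ENNReal.rpow_mul]
  norm_num

theorem ennreal_rpow_le_of_comparable {x y κ : ℝ≥0∞} (hx : x ≠ 0) (hx' : x ≠ ∞) (hy : y ≠ 0)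
    (hy' : y ≠ ∞) (hxy : x ≤ κ * y) (hyx : y ≤ κ * x) (b : ℝ) :
    x ^ b ≤ κ ^ |b| * y ^ b := by
  rcases le_total 0 b with hb | hb
  · rw [abs_of_nonneg hb, ← ENNReal.mul_rpow_of_nonneg _ _ hb]
    exact ENNReal.rpow_le_rpow hxy hb
  · rw [abs_of_nonpos hb]
    have inverse : y ^ (-b) ≤ κ ^ (-b) * x ^ (-b) := by
      rw [← ENNReal.mul_rpow_of_nonneg _ _ (neg_nonneg.2 hb)]
      exact ENNReal.rpow_le_rpow hyx (neg_nonneg.2 hb)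
    calc x ^ b = y ^ (-b) * y ^ b * x ^ b := by simp [← ENNReal.rpow_add _ _ hy hy']
      _ ≤ κ ^ (-b) * x ^ (-b) * y ^ b * x ^ b := by gcongr
      _ = κ ^ (-b) * y ^ b * (x ^ (-b) * x ^ b) := by ring
      _ = κ ^ (-b) * y ^ b := by simp [← ENNReal.rpow_add _ _ hx hx']

end PowersOfTwo

section Hardy

variable {q r : ℝ≥0∞}

theorem eLpNorm_geometric_int_ne_top (hr : r < 1) (hq : q ≠ 0) :
    eLpNorm (fun k : ℤ => r ^ k.natAbs) q Measure.count ≠ ∞ := by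
  have hp : min q 1 ≠ 0 := (lt_min hq.bot_lt one_pos).ne'
  have hp' : min q 1 ≠ ∞ := ne_top_of_le_ne_top ENNReal.one_ne_top (min_le_right _ _)
  refine ne_top_of_le_ne_top ?_ (eLpNorm_count_le_of_exponent_le hp (min_le_left q 1) _)
  set s := (min q 1).toReal
  have hs : 0 < s := ENNReal.toReal_pos hp hp'
  have hrs : r ^ s < 1 := ENNReal.rpow_lt_one hr hs
  have geometric : ∑' k : ℕ, (r ^ s) ^ k ≠ ∞ := by
    rw [ENNReal.tsum_geometric, ENNReal.inv_ne_top]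
    exact (tsub_pos_of_lt hrs).ne'
  have geometric_int : ∑' k : ℤ, (r ^ s) ^ k.natAbs ≠ ∞ := by
    rw [tsum_of_nat_of_neg_add_one ENNReal.summable ENNReal.summable]
    refine ENNReal.add_ne_top.2 ⟨by simpa using geometric, ne_top_of_le_ne_top geometric ?_⟩
    exact ENNReal.tsum_le_tsum fun k => pow_le_pow_right_of_le_one' hrs.le (by lia)
  rw [← lt_top_iff_ne_top, ← ENNReal.rpow_lt_top_iff_of_pos hs, eLpNorm_count_rpow_toReal hp hp',
    lt_top_iff_ne_top]
  have rpow_pow_comm (k : ℕ) : (r ^ k) ^ s = (r ^ s) ^ k := by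
    rw [← ENNReal.rpow_natCast_mul, mul_comm, ENNReal.rpow_mul_natCast]
  change ∑' k : ℤ, (r ^ k.natAbs) ^ s ≠ ∞
  simpa only [rpow_pow_comm] using geometric_int

theorem eLpNorm_geometric_ne_top (hr : r < 1) (hq : q ≠ 0) :
    eLpNorm (fun k : ℕ => r ^ k) q Measure.count ≠ ∞ :=
  ne_top_of_le_ne_top (eLpNorm_geometric_int_ne_top hr hq)
    (eLpNorm_count_comp_le Nat.cast_injective (fun k : ℤ => r ^ k.natAbs) q)

theorem eLpNorm_iSup_geometric_shift_le (hq : q ≠ 0) (D : ℕ → ℝ≥0∞) :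
    eLpNorm (fun l => ⨆ d, r ^ d * D (l + d)) q Measure.count ≤
      eLpNorm (fun d : ℕ => r ^ d) q Measure.count * eLpNorm D q Measure.count :=
  calc eLpNorm (fun l => ⨆ d, r ^ d * D (l + d)) q Measure.count
      ≤ eLpNorm (fun l => eLpNorm (fun d => r ^ d * D (l + d)) q Measure.count)
          q Measure.count := by
        refine eLpNorm_mono_enorm fun l => ?_
        simpa only [enorm_eq_self, iSup_le_iff] using fun d =>
          enorm_le_eLpNorm_count (fun d => r ^ d * D (l + d)) d hq
    _ = eLpNorm (fun d => eLpNorm (fun l => r ^ d * D (l + d)) q Measure.count)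
          q Measure.count := eLpNorm_count_comm _ q
    _ ≤ eLpNorm (fun d => eLpNorm D q Measure.count * r ^ d) q Measure.count := by
        refine eLpNorm_mono_enorm fun d => ?_
        rw [enorm_eq_self, enorm_eq_self, mul_comm]
        refine (eLpNorm_le_const_mul_of_discrete q fun _ => le_rfl).trans ?_
        gcongr
        exact eLpNorm_count_comp_le (add_left_injective d) D q
    _ ≤ eLpNorm (fun d : ℕ => r ^ d) q Measure.count * eLpNorm D q Measure.count := by
        rw [mul_comm]
        exact eLpNorm_le_const_mul_of_discrete q fun _ => le_rfl

theorem eLpNorm_count_comp_pred_le (x : ℕ → ℝ≥0∞) (q : ℝ≥0∞) :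
    eLpNorm (fun l => x (l - 1)) q Measure.count ≤ 2 ^ recip q * eLpNorm x q Measure.count := by
  have hmap : Measure.count.map Nat.pred ≤ (2 : ℝ≥0∞) • Measure.count := by
    refine Measure.le_iff.2 fun s _ => ?_
    have hs : Nat.pred ⁻¹' s ⊆ Nat.succ '' s ∪ s := by
      rintro (_ | n) hn
      · exact Or.inr hn
      · exact Or.inl ⟨n, hn, rfl⟩
    calc Measure.count.map Nat.pred s = Measure.count (Nat.pred ⁻¹' s) :=
          Measure.map_apply .of_discrete .of_discrete
      _ ≤ Measure.count (Nat.succ '' s) + Measure.count s :=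
          (measure_mono hs).trans (measure_union_le _ _)
      _ = 2 * Measure.count s := by
          rw [Measure.count_injective_image Nat.succ_injective, two_mul]
  calc eLpNorm (fun l => x (l - 1)) q Measure.count
      = eLpNorm x q (Measure.count.map Nat.pred) :=
        (eLpNorm_map_measure Measurable.of_discrete.aestronglyMeasurable
          Measurable.of_discrete.aemeasurable).symm
    _ ≤ 2 ^ recip q * eLpNorm x q Measure.count := by
        simpa [recip] using eLpNorm_le_of_measure_le_smul hmap (f := x) (p := q)

/-- The `ℓ²` norm of the tail `(x n, x (n + 1), …)` of a sequence. -/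
noncomputable def tailNorm (x : ℕ → ℝ≥0∞) (n : ℕ) : ℝ≥0∞ :=
  eLpNorm x 2 (Measure.count.restrict (Ici n))

theorem tailNorm_eq_eLpNorm_shift (x : ℕ → ℝ≥0∞) (n : ℕ) :
    tailNorm x n = eLpNorm (fun d => x (n + d)) 2 Measure.count := by
  have hrange : range (n + ·) = Ici n := by
    ext i
    simp [le_iff_exists_add, eq_comm]
  rw [tailNorm, ← hrange, ← eLpNorm_count_comp (add_right_injective n)]
  rfl

theorem eLpNorm_count_two_sq {X : Type*} [MeasurableSpace X] [MeasurableSingletonClass X]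
    (x : X → ℝ≥0∞) : eLpNorm x 2 Measure.count ^ 2 = ∑' i, x i ^ 2 := by
  simpa using eLpNorm_count_rpow_toReal two_ne_zero ENNReal.ofNat_ne_top x

theorem tailNorm_sq (x : ℕ → ℝ≥0∞) (n : ℕ) : tailNorm x n ^ 2 = ∑' d, x (n + d) ^ 2 := by
  rw [tailNorm_eq_eLpNorm_shift, eLpNorm_count_two_sq]

/-- Hardy's inequality for `ℓ²` tails. -/
theorem eLpNorm_weighted_tailNorm_le {δ : ℝ} (hδ : 0 < δ) (hq : q ≠ 0) :
    ∃ C ≠ ∞, ∀ A : ℕ → ℝ≥0∞,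
      eLpNorm (fun l : ℕ => 2 ^ (δ * l) * tailNorm A l) q Measure.count ≤
        C * eLpNorm (fun l : ℕ => 2 ^ (δ * l) * A l) q Measure.count := by
  set r : ℝ≥0∞ := 2 ^ (-(δ / 2)) with hr
  have hr1 : r < 1 := two_rpow_neg_lt_one (half_pos hδ)
  refine ⟨eLpNorm (fun d : ℕ => r ^ d) 2 Measure.count *
    eLpNorm (fun d : ℕ => r ^ d) q Measure.count,
    ENNReal.mul_ne_top (eLpNorm_geometric_ne_top hr1 two_ne_zero)
      (eLpNorm_geometric_ne_top hr1 hq), fun A => ?_⟩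
  set D : ℕ → ℝ≥0∞ := fun l => 2 ^ (δ * l) * A l
  -- Half of the decay `2 ^ (-δ d)` makes the `ℓ²` sum over `d` converge, the other half goes
  -- into the supremum.
  have splitting (l d : ℕ) : A (l + d) ≤
      2 ^ (-(δ * l)) * (⨆ d, r ^ d * D (l + d)) * r ^ d := by
    calc A (l + d) = 2 ^ (-(δ * l)) * (r ^ d * D (l + d)) * r ^ d := by
          have weight : (2 : ℝ≥0∞) ^ (-(δ * l)) * (r ^ d * 2 ^ (δ * (l + d : ℕ))) * r ^ d = 1 := by
            simp only [hr, ← two_rpow_mul_natCast, ← two_rpow_add]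
            rw [← ENNReal.rpow_zero (x := 2)]
            congr 1
            push_cast
            ring
          rw [← one_mul (A (l + d)), ← weight]
          ring
      _ ≤ _ := by
          gcongr
          exact le_iSup (fun d => r ^ d * D (l + d)) d
  have tail (l : ℕ) : 2 ^ (δ * l) * tailNorm A l ≤
      eLpNorm (fun d : ℕ => r ^ d) 2 Measure.count * ⨆ d, r ^ d * D (l + d) := by
    calc 2 ^ (δ * l) * tailNorm A l
        ≤ 2 ^ (δ * l) * (2 ^ (-(δ * l)) * (⨆ d, r ^ d * D (l + d)) *
            eLpNorm (fun d : ℕ => r ^ d) 2 Measure.count) := by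
          rw [tailNorm_eq_eLpNorm_shift]
          gcongr
          exact eLpNorm_le_const_mul_of_discrete 2 (splitting l)
      _ = 2 ^ (δ * l) * 2 ^ (-(δ * l)) * (eLpNorm (fun d : ℕ => r ^ d) 2 Measure.count *
            ⨆ d, r ^ d * D (l + d)) := by ring
      _ = _ := by rw [← two_rpow_add, add_neg_cancel, ENNReal.rpow_zero, one_mul]
  rw [mul_assoc]
  exact (eLpNorm_le_const_mul_of_discrete q tail).trans
    (mul_le_mul_right (eLpNorm_iSup_geometric_shift_le hq D) _)

end Hardy

section LogBlocks

/-- The `l`-th block of indices `j`, those with `2 ^ l ≤ j + 1 < 2 ^ (l + 1)`. -/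
def logBlock (l : ℕ) : Set ℕ := {j | Nat.log 2 (j + 1) = l}

theorem mem_logBlock {l j : ℕ} : j ∈ logBlock l ↔ 2 ^ l ≤ j + 1 ∧ j + 1 < 2 ^ (l + 1) := by
  rw [logBlock, mem_ofPred_eq, Nat.log_eq_iff]
  simp

theorem count_logBlock (l : ℕ) : Measure.count (logBlock l) = (2 : ℝ≥0∞) ^ l := by
  have hpow := Nat.one_le_two_pow (n := l)
  have logBlock_eq : logBlock l = ↑(Finset.Ico (2 ^ l - 1) (2 ^ (l + 1) - 1)) := by
    ext j
    simp only [mem_logBlock, Finset.coe_Ico, mem_Ico]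
    lia
  have card : 2 ^ (l + 1) - 1 - (2 ^ l - 1) = 2 ^ l := by
    rw [pow_succ]
    lia
  rw [logBlock_eq, Measure.count_apply_finset, Nat.card_Ico, card, Nat.cast_pow, Nat.cast_ofNat]

theorem iUnion_logBlock : ⋃ l, logBlock l = univ :=
  eq_univ_of_forall fun _ => mem_iUnion.2 ⟨_, rfl⟩

theorem iUnion_logBlock_add (l : ℕ) : ⋃ d, logBlock (l + d) = Ici (2 ^ l - 1) := by
  ext j
  simp only [mem_iUnion, logBlock, mem_ofPred_eq, mem_Ici]
  rw [tsub_le_iff_right, ← Nat.le_log_iff_pow_le one_lt_two j.succ_ne_zero, le_iff_exists_add]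

theorem pairwise_disjoint_logBlock : Pairwise (Function.onFun Disjoint logBlock) := by
  refine fun l m hlm => Set.disjoint_left.2 fun j (hj : _ = l) (hj' : _ = m) => hlm ?_
  rw [← hj, ← hj']

theorem natCast_succ_rpow_le_of_mem_logBlock {l j : ℕ} (hj : j ∈ logBlock l) (b : ℝ) :
    ((j + 1 : ℕ) : ℝ≥0∞) ^ b ≤ 2 ^ |b| * 2 ^ (b * l) := by
  obtain ⟨hle, hlt⟩ := mem_logBlock.1 hj
  have two_rpow_eq : (2 : ℝ≥0∞) ^ (b * l) = ((2 ^ l : ℕ) : ℝ≥0∞) ^ b := by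
    rw [mul_comm, ENNReal.rpow_mul, ENNReal.rpow_natCast, Nat.cast_pow, Nat.cast_ofNat]
  rw [two_rpow_eq]
  refine ennreal_rpow_le_of_comparable (by positivity) (ENNReal.natCast_ne_top _) (by positivity)
    (ENNReal.natCast_ne_top _) ?_ ?_ b <;> norm_cast
  · rw [pow_succ] at hlt
    lia
  · lia

/-- The `ℓ²` norm over the block `logBlock l`. -/
noncomputable def blockNorm (x : ℕ → ℝ≥0∞) (l : ℕ) : ℝ≥0∞ :=
  eLpNorm x 2 (Measure.count.restrict (logBlock l))

theorem tailNorm_blockNorm (x : ℕ → ℝ≥0∞) (l : ℕ) :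
    tailNorm (blockNorm x) l = tailNorm x (2 ^ l - 1) := by
  rw [tailNorm_eq_eLpNorm_shift, tailNorm, ← iUnion_logBlock_add,
    eLpNorm_restrict_iUnion (fun _ => .of_discrete)
      (pairwise_disjoint_logBlock.comp_of_injective (add_right_injective l))]
  rfl

theorem blockNorm_le_tailNorm (x : ℕ → ℝ≥0∞) (l : ℕ) :
    blockNorm x l ≤ tailNorm x (2 ^ l - 1) := by
  rw [blockNorm, tailNorm, ← iUnion_logBlock_add]
  exact eLpNorm_mono_measure _ (Measure.restrict_mono (subset_iUnion _ 0) le_rfl)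

theorem eLpNorm_count_eq_logBlock (x : ℕ → ℝ≥0∞) (q : ℝ≥0∞) :
    eLpNorm x q Measure.count =
      eLpNorm (fun l => eLpNorm x q (Measure.count.restrict (logBlock l))) q Measure.count := by
  rw [← eLpNorm_restrict_iUnion (fun _ => .of_discrete) pairwise_disjoint_logBlock,
    iUnion_logBlock, Measure.restrict_univ]

theorem eLpNorm_logBlock_le_mul {p q : ℝ≥0∞} (hq : q ≠ 0) (x : ℕ → ℝ≥0∞) (l : ℕ) :
    eLpNorm x p (Measure.count.restrict (logBlock l)) ≤
      2 ^ ((recip p - recip (max p q)) * l) *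
        eLpNorm x q (Measure.count.restrict (logBlock l)) := by
  rw [two_rpow_mul_natCast, ← ENNReal.rpow_mul_natCast, mul_comm _ (l : ℝ),
    ENNReal.rpow_natCast_mul, ← count_logBlock]
  exact eLpNorm_count_restrict_le_mul hq x (logBlock l)

theorem eLpNorm_blockNorm_le {q : ℝ≥0∞} (hq : q ≠ 0) (b : ℝ) (x : ℕ → ℝ≥0∞) :
    eLpNorm (fun l : ℕ => 2 ^ ((b - recip 2 + recip (max 2 q)) * l) * blockNorm x l) q
        Measure.count ≤
      2 ^ |b| * eLpNorm (fun j => ((j + 1 : ℕ) : ℝ≥0∞) ^ b * x j) q Measure.count := by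
  rw [eLpNorm_count_eq_logBlock fun j => ((j + 1 : ℕ) : ℝ≥0∞) ^ b * x j]
  refine eLpNorm_le_const_mul_of_discrete q fun l => ?_
  set N := eLpNorm (fun j => ((j + 1 : ℕ) : ℝ≥0∞) ^ b * x j) q (Measure.count.restrict (logBlock l))
  have weighted : eLpNorm x q (Measure.count.restrict (logBlock l)) ≤
      2 ^ |b| * 2 ^ (-b * l) * N := by
    refine eLpNorm_restrict_le_const_mul_of_discrete q fun j hj => ?_
    calc x j = ((j + 1 : ℕ) : ℝ≥0∞) ^ (-b) * (((j + 1 : ℕ) : ℝ≥0∞) ^ b * x j) := by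
          rw [← mul_assoc, ← ENNReal.rpow_add _ _ (by positivity) (ENNReal.natCast_ne_top _),
            neg_add_cancel, ENNReal.rpow_zero, one_mul]
      _ ≤ _ := by
          rw [← abs_neg b]
          gcongr
          exact natCast_succ_rpow_le_of_mem_logBlock hj (-b)
  calc 2 ^ ((b - recip 2 + recip (max 2 q)) * l) * blockNorm x l
      ≤ 2 ^ ((b - recip 2 + recip (max 2 q)) * l) * (2 ^ ((recip 2 - recip (max 2 q)) * l) *
          (2 ^ |b| * 2 ^ (-b * l) * N)) := by
        gcongr
        exact (eLpNorm_logBlock_le_mul hq x l).trans (by gcongr)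
    _ = 2 ^ |b| * (2 ^ ((b - recip 2 + recip (max 2 q)) * l) *
          2 ^ ((recip 2 - recip (max 2 q)) * l) * 2 ^ (-b * l) * N) := by ring
    _ = 2 ^ |b| * N := by
        rw [← two_rpow_add, ← two_rpow_add, ← add_mul, ← add_mul]
        ring_nf
        simp

theorem eLpNorm_le_blockNorm (q : ℝ≥0∞) (b : ℝ) (x : ℕ → ℝ≥0∞) :
    eLpNorm (fun j => ((j + 1 : ℕ) : ℝ≥0∞) ^ b * x j) q Measure.count ≤
      2 ^ |b| * eLpNorm (fun l : ℕ => 2 ^ ((b + recip q - recip (max q 2)) * l) * blockNorm x l) q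
        Measure.count := by
  rw [eLpNorm_count_eq_logBlock]
  refine eLpNorm_le_const_mul_of_discrete q fun l => ?_
  calc eLpNorm (fun j => ((j + 1 : ℕ) : ℝ≥0∞) ^ b * x j) q (Measure.count.restrict (logBlock l))
      ≤ 2 ^ |b| * 2 ^ (b * l) * eLpNorm x q (Measure.count.restrict (logBlock l)) := by
        refine eLpNorm_restrict_le_const_mul_of_discrete q fun j hj => ?_
        gcongr
        exact natCast_succ_rpow_le_of_mem_logBlock hj b
    _ ≤ 2 ^ |b| * 2 ^ (b * l) * (2 ^ ((recip q - recip (max q 2)) * l) * blockNorm x l) := by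
        gcongr
        exact eLpNorm_logBlock_le_mul two_ne_zero x l
    _ = _ := by
        rw [mul_assoc, ← mul_assoc (2 ^ (b * l)), ← two_rpow_add, ← add_mul, add_sub_assoc]

end LogBlocks

section DyadicDiscretization

variable {ι : Type*}

theorem recip_two : recip 2 = 1 / 2 := by simp [recip]

theorem recip_nonneg (q : ℝ≥0∞) : 0 ≤ recip q := ENNReal.toReal_nonneg

theorem seqRearr_antitone (c : ι → ℂ) : Antitone (seqRearr c) := fun _ _ hkm =>
  sInf_le_sInf fun s (hs : {n | s < ‖c n‖ₑ}.encard ≤ _) => hs.trans (Nat.cast_le.2 hkm)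

theorem funRearr_antitone (f : ℝ → ℂ) : Antitone (funRearr f) := fun _ _ hst =>
  sInf_le_sInf fun s (hs : volI {x | s < ‖f x‖ₑ} ≤ _) => hs.trans (ENNReal.ofReal_le_ofReal hst)

/-- The dyadic samples `2 ^ (j / 2) c^*_{2 ^ j}` of the rearrangement of a family of numbers. -/
noncomputable def seqDyadic (c : ι → ℂ) (j : ℕ) : ℝ≥0∞ :=
  2 ^ ((1 / 2 : ℝ) * j) * seqRearr c (2 ^ j - 1)

/-- The dyadic samples `2 ^ (-j / 2) f^*(2 ^ (-j))` of the rearrangement of a function. -/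
noncomputable def funDyadic (f : ℝ → ℂ) (j : ℕ) : ℝ≥0∞ :=
  2 ^ (-(1 / 2 : ℝ) * j) * funRearr f ((1 / 2) ^ j)

theorem ofReal_rpow_le_of_comparable {u v : ℝ} (hu : 0 < u) (hv : 0 < v) (huv : u ≤ 2 * v)
    (hvu : v ≤ 2 * u) (b : ℝ) :
    ENNReal.ofReal (u ^ b) ≤ 2 ^ |b| * ENNReal.ofReal (v ^ b) := by
  rw [← ENNReal.ofReal_rpow_of_pos hu, ← ENNReal.ofReal_rpow_of_pos hv]
  refine ennreal_rpow_le_of_comparable (by simpa using hu) ENNReal.ofReal_ne_top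
    (by simpa using hv) ENNReal.ofReal_ne_top ?_ ?_ b <;>
  · rw [← ENNReal.ofReal_ofNat, ← ENNReal.ofReal_mul zero_le_two]
    exact ENNReal.ofReal_le_ofReal ‹_›

theorem one_add_log_comparable {u : ℝ} {j : ℕ} (hu : 1 ≤ u) (huj : u ≤ 2 ^ j)
    (hju : 2 ^ j ≤ 2 * u) :
    1 + Real.log u ≤ 2 * (j + 1) ∧ (j : ℝ) + 1 ≤ 2 * (1 + Real.log u) := by
  have hu0 : 0 < u := one_pos.trans_le hu
  have upper : Real.log u ≤ j * Real.log 2 := by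
    rw [← Real.log_pow]
    exact Real.log_le_log hu0 huj
  have lower : j * Real.log 2 ≤ Real.log 2 + Real.log u := by
    rw [← Real.log_pow, ← Real.log_mul two_ne_zero hu0.ne']
    exact Real.log_le_log (by positivity) hju
  have := Real.log_nonneg hu
  have := Real.log_two_gt_d9
  have := Real.log_two_lt_d9
  have : (0 : ℝ) ≤ j := j.cast_nonneg
  constructor <;> nlinarith

theorem ofReal_two_pow_rpow (j : ℕ) (e : ℝ) :
    ENNReal.ofReal (((2 : ℝ) ^ j) ^ e) = 2 ^ (e * j) := by
  rw [← ENNReal.ofReal_rpow_of_pos (by positivity), ENNReal.ofReal_pow zero_le_two,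
    ENNReal.ofReal_ofNat, mul_comm, ENNReal.rpow_natCast_mul]

theorem ofReal_natCast_succ_rpow (j : ℕ) (b : ℝ) :
    ENNReal.ofReal (((j : ℝ) + 1) ^ b) = ((j + 1 : ℕ) : ℝ≥0∞) ^ b := by
  rw [← ENNReal.ofReal_rpow_of_pos (by positivity), ← ENNReal.ofReal_natCast]
  push_cast
  rfl

theorem ofReal_logWeight_le {u : ℝ} {j : ℕ} (hu : 1 ≤ u) (huj : u ≤ 2 ^ j) (hju : 2 ^ j ≤ 2 * u)
    (e b : ℝ) :
    ENNReal.ofReal (u ^ e * (1 + Real.log u) ^ b) ≤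
      2 ^ (|e| + |b|) * (2 ^ (e * j) * ((j + 1 : ℕ) : ℝ≥0∞) ^ b) := by
  obtain ⟨upper, lower⟩ := one_add_log_comparable hu huj hju
  have hlog := Real.log_nonneg hu
  rw [ENNReal.ofReal_mul (by positivity), two_rpow_add, mul_mul_mul_comm,
    ← ofReal_two_pow_rpow, ← ofReal_natCast_succ_rpow]
  exact mul_le_mul'
    (ofReal_rpow_le_of_comparable (by linarith) (by positivity) (by linarith) hju e)
    (ofReal_rpow_le_of_comparable (by linarith) (by positivity) upper lower b)

theorem le_ofReal_logWeight {u : ℝ} {j : ℕ} (hu : 1 ≤ u) (huj : u ≤ 2 ^ j) (hju : 2 ^ j ≤ 2 * u)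
    (e b : ℝ) :
    2 ^ (e * j) * ((j + 1 : ℕ) : ℝ≥0∞) ^ b ≤
      2 ^ (|e| + |b|) * ENNReal.ofReal (u ^ e * (1 + Real.log u) ^ b) := by
  obtain ⟨upper, lower⟩ := one_add_log_comparable hu huj hju
  have hlog := Real.log_nonneg hu
  rw [ENNReal.ofReal_mul (by positivity), two_rpow_add, mul_mul_mul_comm,
    ← ofReal_two_pow_rpow, ← ofReal_natCast_succ_rpow]
  exact mul_le_mul'
    (ofReal_rpow_le_of_comparable (by positivity) (by linarith) hju (by linarith) e)
    (ofReal_rpow_le_of_comparable (by positivity) (by linarith) lower upper b)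

theorem seqDyadic_le_eLpNorm_logBlock {q : ℝ≥0∞} (hq : q ≠ 0) (b : ℝ) (c : ι → ℂ) (j : ℕ) :
    ((j + 1 : ℕ) : ℝ≥0∞) ^ b * seqDyadic c j ≤
      2 ^ (|recip 2 - recip q| + |b| + recip q) *
        eLpNorm (fun k : ℕ => ENNReal.ofReal (((k : ℝ) + 1) ^ (recip 2 - recip q) *
          (1 + Real.log ((k : ℝ) + 1)) ^ b) * seqRearr c k) q
          (Measure.count.restrict (logBlock (j - 1))) := by
  set e := recip 2 - recip q with he
  set v : ℝ≥0∞ := 2 ^ (e * j) * ((j + 1 : ℕ) : ℝ≥0∞) ^ b * seqRearr c (2 ^ j - 1) with hv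
  have pointwise (k : ℕ) (hk : k ∈ logBlock (j - 1)) : v ≤ 2 ^ (|e| + |b|) *
      (ENNReal.ofReal (((k : ℝ) + 1) ^ e * (1 + Real.log ((k : ℝ) + 1)) ^ b) * seqRearr c k) := by
    obtain ⟨hle, hlt⟩ := mem_logBlock.1 hk
    have range_k : k + 1 ≤ 2 ^ j ∧ 2 ^ j ≤ 2 * (k + 1) := by
      cases j with
      | zero => lia
      | succ j =>
        rw [Nat.add_sub_cancel] at hle hlt
        rw [pow_succ] at hlt ⊢
        lia
    rw [hv, ← mul_assoc (2 ^ (|e| + |b|))]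
    exact mul_le_mul' (le_ofReal_logWeight (by simp) (mod_cast range_k.1)
      (mod_cast range_k.2) e b) (seqRearr_antitone c (by lia))
  have block_rpow : (2 : ℝ≥0∞) ^ (recip q * j) ≤
      2 ^ recip q * Measure.count (logBlock (j - 1)) ^ recip q := by
    rw [count_logBlock, ← ENNReal.mul_rpow_of_nonneg _ _ (recip_nonneg q), ← pow_succ', mul_comm,
      ENNReal.rpow_natCast_mul]
    exact ENNReal.rpow_le_rpow (pow_le_pow_right₀ one_le_two (by lia)) (recip_nonneg q)
  have norm_const : v * Measure.count (logBlock (j - 1)) ^ recip q =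
      eLpNorm (fun _ => v) q (Measure.count.restrict (logBlock (j - 1))) := by
    rw [eLpNorm_const _ hq (by simp [count_logBlock, ← Measure.measure_univ_eq_zero])]
    simp [recip]
  calc ((j + 1 : ℕ) : ℝ≥0∞) ^ b * seqDyadic c j = v * 2 ^ (recip q * j) := by
        have : (2 : ℝ≥0∞) ^ ((1 / 2 : ℝ) * j) = 2 ^ (e * j) * 2 ^ (recip q * j) := by
          rw [← two_rpow_add, ← add_mul, he, recip_two, sub_add_cancel]
        rw [hv, seqDyadic, this]
        ring
    _ ≤ v * (2 ^ recip q * Measure.count (logBlock (j - 1)) ^ recip q) := by gcongr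
    _ = 2 ^ recip q * eLpNorm (fun _ => v) q (Measure.count.restrict (logBlock (j - 1))) := by
        rw [← norm_const]
        ring
    _ ≤ _ := by
        rw [two_rpow_add, mul_comm _ (2 ^ recip q), mul_assoc]
        gcongr
        exact eLpNorm_restrict_le_const_mul_of_discrete q pointwise

theorem eLpNorm_seqDyadic_le {q : ℝ≥0∞} (hq : q ≠ 0) (b : ℝ) (c : ι → ℂ) :
    eLpNorm (fun j : ℕ => ((j + 1 : ℕ) : ℝ≥0∞) ^ b * seqDyadic c j) q Measure.count ≤
      2 ^ (|recip 2 - recip q| + |b| + 2 * recip q) * seqLZNorm 2 q b c := by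
  refine (eLpNorm_le_const_mul_of_discrete q
    (seqDyadic_le_eLpNorm_logBlock hq b c)).trans ?_
  refine (mul_le_mul_right (eLpNorm_count_comp_pred_le
    (fun l => eLpNorm _ q (Measure.count.restrict (logBlock l))) q) _).trans_eq ?_
  rw [← eLpNorm_count_eq_logBlock, ← mul_assoc, ← two_rpow_add, seqLZNorm]
  ring_nf

theorem iUnion_Ioc_half_pow : ⋃ j : ℕ, Ioc ((1 / 2 : ℝ) ^ (j + 1)) ((1 / 2) ^ j) = Ioc 0 1 := by
  ext t
  simp only [mem_iUnion]
  refine ⟨fun ⟨j, hj⟩ => ⟨lt_trans (by positivity) hj.1, hj.2.trans ?_⟩, fun ht => ?_⟩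
  · exact pow_le_one₀ (by norm_num) (by norm_num)
  · exact exists_nat_pow_near_of_lt_one ht.1 ht.2 (by norm_num) (by norm_num)

theorem funLZNorm_eq_eLpNorm_iUnion (q : ℝ≥0∞) (b : ℝ) (f : ℝ → ℂ) :
    funLZNorm 2 q b f = eLpNorm (fun j : ℕ => eLpNorm (fun t : ℝ =>
      ENNReal.ofReal (t ^ (recip 2 - recip q) * (1 + |Real.log t|) ^ b) * funRearr f t) q
        (volume.restrict (Ioc ((1 / 2) ^ (j + 1)) ((1 / 2) ^ j)))) q Measure.count := by
  have antitone_half_pow : Antitone fun j : ℕ => (1 / 2 : ℝ) ^ j :=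
    pow_right_anti₀ (by norm_num) (by norm_num)
  rw [funLZNorm, restrict_Ioo_eq_restrict_Ioc, ← iUnion_Ioc_half_pow]
  exact eLpNorm_restrict_iUnion (fun _ => measurableSet_Ioc)
    antitone_half_pow.pairwise_disjoint_on_Ioc_succ _ q

theorem eLpNorm_restrict_Ioc_le_funDyadic (q : ℝ≥0∞) (b : ℝ) (f : ℝ → ℂ) (j : ℕ) :
    eLpNorm (fun t : ℝ =>
      ENNReal.ofReal (t ^ (recip 2 - recip q) * (1 + |Real.log t|) ^ b) * funRearr f t) q
        (volume.restrict (Ioc ((1 / 2) ^ (j + 1)) ((1 / 2) ^ j))) ≤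
      2 ^ (|recip 2 - recip q| + |b|) *
        (((j + 1 + 1 : ℕ) : ℝ≥0∞) ^ b * funDyadic f (j + 1)) := by
  set e := recip 2 - recip q with he
  set v : ℝ≥0∞ := 2 ^ (|e| + |b|) *
    (2 ^ (-e * (j + 1 : ℕ)) * ((j + 1 + 1 : ℕ) : ℝ≥0∞) ^ b) * funRearr f ((1 / 2) ^ (j + 1)) with hv
  have pointwise (t : ℝ) (ht : t ∈ Ioc ((1 / 2 : ℝ) ^ (j + 1)) ((1 / 2) ^ j)) :
      ENNReal.ofReal (t ^ e * (1 + |Real.log t|) ^ b) * funRearr f t ≤ v := by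
    have ht0 : 0 < t := lt_trans (by positivity) ht.1
    have ht1 : t ≤ 1 := ht.2.trans (pow_le_one₀ (by norm_num) (by norm_num))
    have weight_inv : t ^ e * (1 + |Real.log t|) ^ b =
        t⁻¹ ^ (-e) * (1 + Real.log t⁻¹) ^ b := by
      rw [Real.inv_rpow ht0.le, Real.rpow_neg ht0.le, inv_inv, Real.log_inv,
        abs_of_nonpos (Real.log_nonpos ht0.le ht1)]
    have upper : t⁻¹ ≤ 2 ^ (j + 1) := by
      rw [inv_le_comm₀ ht0 (by positivity), ← inv_pow, ← one_div]
      exact ht.1.le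
    have lower : 2 ^ (j + 1) ≤ 2 * t⁻¹ := by
      rw [pow_succ', mul_le_mul_iff_right₀ two_pos, le_inv_comm₀ (by positivity) ht0, ← inv_pow,
        ← one_div]
      exact ht.2
    rw [weight_inv, hv, ← abs_neg e]
    exact mul_le_mul' (ofReal_logWeight_le ((one_le_inv₀ ht0).2 ht1) upper lower (-e) b)
      (funRearr_antitone f ht.1.le)
  have volume_Ioc : volume (Ioc ((1 / 2 : ℝ) ^ (j + 1)) ((1 / 2) ^ j)) =
      2 ^ (-((j + 1 : ℕ) : ℝ)) := by
    have length : (1 / 2 : ℝ) ^ j - (1 / 2) ^ (j + 1) = (2⁻¹) ^ (j + 1) := by ring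
    rw [Real.volume_Ioc, length, ENNReal.ofReal_pow (by positivity),
      ENNReal.ofReal_inv_of_pos two_pos, ENNReal.ofReal_ofNat, ENNReal.rpow_neg,
      ENNReal.rpow_natCast, ENNReal.inv_pow]
  calc _ ≤ v * volume (Ioc ((1 / 2 : ℝ) ^ (j + 1)) ((1 / 2) ^ j)) ^ recip q := by
        simpa [recip] using eLpNorm_le_of_ae_enorm_bound (p := q)
          (ae_restrict_of_forall_mem (μ := volume) measurableSet_Ioc fun t ht =>
            (enorm_eq_self _).trans_le (pointwise t ht))
    _ = 2 ^ (|e| + |b|) * (((j + 1 + 1 : ℕ) : ℝ≥0∞) ^ b *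
          (2 ^ (-e * (j + 1 : ℕ)) * 2 ^ (-((j + 1 : ℕ) : ℝ) * recip q) *
            funRearr f ((1 / 2) ^ (j + 1)))) := by
        rw [volume_Ioc, hv, ← ENNReal.rpow_mul]
        ring
    _ = _ := by
        rw [funDyadic, ← two_rpow_add, he, recip_two]
        ring_nf

theorem funLZNorm_le_eLpNorm_funDyadic (q : ℝ≥0∞) (b : ℝ) (f : ℝ → ℂ) :
    funLZNorm 2 q b f ≤ 2 ^ (|recip 2 - recip q| + |b|) *
      eLpNorm (fun j : ℕ => ((j + 1 : ℕ) : ℝ≥0∞) ^ b * funDyadic f j) q Measure.count := by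
  rw [funLZNorm_eq_eLpNorm_iUnion]
  refine (eLpNorm_le_const_mul_of_discrete q (eLpNorm_restrict_Ioc_le_funDyadic q b f)).trans ?_
  gcongr
  exact eLpNorm_count_comp_le Nat.succ_injective
    (fun j : ℕ => ((j + 1 : ℕ) : ℝ≥0∞) ^ b * funDyadic f j) q

end DyadicDiscretization

section UpperLevels

variable {ι : Type*} (c : ι → ℂ)

theorem encard_seqRearr_lt_le (k : ℕ) : {n | seqRearr c k < ‖c n‖ₑ}.encard ≤ k := by
  by_contra! hk
  obtain ⟨t, ht, hcard⟩ := exists_subset_encard_eq (Order.add_one_le_of_lt hk)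
  have ht_finite : t.Finite := finite_of_encard_eq_coe (k := k + 1) (by simp [hcard])
  obtain ⟨m, hm, hmin⟩ := exists_min_image t (fun n => ‖c n‖ₑ) ht_finite
    (by simp [← encard_pos, hcard])
  obtain ⟨s, hs : {n | s < ‖c n‖ₑ}.encard ≤ k, hsm⟩ := sInf_lt_iff.1 (mem_ofPred_eq ▸ ht hm)
  have ht_le : t.encard ≤ k := (encard_le_encard fun n hn => hsm.trans_le (hmin n hn)).trans hs
  rw [hcard] at ht_le
  exact absurd ht_le (not_le.2 (mod_cast k.lt_succ_self))

/-- The (at most `2 ^ j - 1`) indices of the terms of `c` exceeding `c^*_{2 ^ j}`. -/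
noncomputable def upperLevel (j : ℕ) : Finset ι :=
  (finite_of_encard_le_coe (encard_seqRearr_lt_le c (2 ^ j - 1))).toFinset

variable {c}

theorem mem_upperLevel {n : ι} {j : ℕ} :
    n ∈ upperLevel c j ↔ seqRearr c (2 ^ j - 1) < ‖c n‖ₑ :=
  Finite.mem_toFinset _

theorem card_upperLevel_le (j : ℕ) : (upperLevel c j).card ≤ 2 ^ j - 1 := by
  have := encard_seqRearr_lt_le c (2 ^ j - 1)
  rw [← Finite.coe_toFinset (finite_of_encard_le_coe this), encard_coe_eq_coe_finsetCard] at this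
  exact mod_cast this

theorem upperLevel_zero : upperLevel c 0 = ∅ := by
  simpa using card_upperLevel_le (c := c) 0

theorem upperLevel_mono : Monotone (upperLevel c) := fun _ _ hij _ hn =>
  mem_upperLevel.2 ((seqRearr_antitone c
    (Nat.sub_le_sub_right (Nat.pow_le_pow_right two_pos hij) 1)).trans_lt (mem_upperLevel.1 hn))

theorem exists_mem_upperLevel_succ {n : ι} {J i : ℕ} (hi : n ∈ upperLevel c i)
    (hJ : n ∉ upperLevel c J) : ∃ d, n ∈ upperLevel c (J + d + 1) ∧ n ∉ upperLevel c (J + d) := by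
  induction i with
  | zero => exact absurd (upperLevel_mono J.zero_le hi) hJ
  | succ i ih =>
    by_cases hni : n ∈ upperLevel c i
    · exact ih hni
    · have hJi : J ≤ i := not_lt.1 fun hlt => hJ (upperLevel_mono hlt hi)
      obtain ⟨d, rfl⟩ := Nat.exists_eq_add_of_le hJi
      exact ⟨d, hi, hni⟩

theorem seqDyadic_sq (c : ι → ℂ) (j : ℕ) :
    seqDyadic c j ^ 2 = 2 ^ j * seqRearr c (2 ^ j - 1) ^ 2 := by
  rw [seqDyadic, mul_pow, mul_comm (1 / 2 : ℝ), ENNReal.rpow_natCast_mul, ennreal_rpow_half_sq]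

theorem exists_mem_upperLevel {J : ℕ} (hJ : tailNorm (seqDyadic c) J ≠ ∞) {n : ι}
    (hn : c n ≠ 0) : ∃ i, n ∈ upperLevel c i := by
  by_contra! hni
  have lower_bound (d : ℕ) : ‖c n‖ₑ ^ 2 ≤ seqDyadic c (J + d) ^ 2 := by
    rw [seqDyadic_sq]
    exact (pow_le_pow_left' (not_lt.1 (mem_upperLevel.not.1 (hni _))) 2).trans
      (le_mul_of_one_le_left' (one_le_pow₀ one_le_two))
  refine ENNReal.pow_ne_top (n := 2) hJ (top_le_iff.1 ?_)
  rw [tailNorm_sq, ← ENNReal.tsum_const_eq_top_of_ne_zero (α := ℕ) (c := ‖c n‖ₑ ^ 2) (by simpa)]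
  exact ENNReal.tsum_le_tsum lower_bound

theorem tsum_indicator_upperLevel_le (J i : ℕ) (v : ℝ≥0∞) :
    ∑' n : {n // n ∉ upperLevel c J},
      (upperLevel c i : Set ι).indicator (fun _ => v) n ≤ 2 ^ i * v := by
  refine (ENNReal.tsum_comp_le_tsum_of_injective Subtype.val_injective _).trans ?_
  rw [← sum_eq_tsum_indicator, Finset.sum_const, nsmul_eq_mul]
  gcongr
  exact mod_cast (card_upperLevel_le i).trans (Nat.sub_le _ _)

theorem tsum_notMem_upperLevel_sq_le (c : ι → ℂ) (J : ℕ) :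
    ∑' n : {n // n ∉ upperLevel c J}, ‖c n‖ₑ ^ 2 ≤ 2 * tailNorm (seqDyadic c) J ^ 2 := by
  by_cases hJ : tailNorm (seqDyadic c) J = ∞
  · simp [hJ]
  let v (d : ℕ) : ℝ≥0∞ := seqRearr c (2 ^ (J + d) - 1) ^ 2
  have layer (n : {n // n ∉ upperLevel c J}) : ‖c n‖ₑ ^ 2 ≤
      ∑' d, (upperLevel c (J + d + 1) : Set ι).indicator (fun _ => v d) n := by
    by_cases hcn : c n = 0
    · simp [hcn]
    obtain ⟨i, hi⟩ := exists_mem_upperLevel hJ hcn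
    obtain ⟨d, hd, hd'⟩ := exists_mem_upperLevel_succ hi n.2
    refine le_trans ?_ (ENNReal.le_tsum d)
    rw [indicator_of_mem (Finset.mem_coe.2 hd)]
    exact pow_le_pow_left' (not_lt.1 (mem_upperLevel.not.1 hd')) 2
  calc ∑' n : {n // n ∉ upperLevel c J}, ‖c n‖ₑ ^ 2
      ≤ ∑' d, ∑' n : {n // n ∉ upperLevel c J},
          (upperLevel c (J + d + 1) : Set ι).indicator (fun _ => v d) n := by
        rw [ENNReal.tsum_comm]
        exact ENNReal.tsum_le_tsum layer
    _ ≤ ∑' d, 2 * seqDyadic c (J + d) ^ 2 := by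
        refine ENNReal.tsum_le_tsum fun d => (tsum_indicator_upperLevel_le J _ _).trans_eq ?_
        rw [seqDyadic_sq]
        ring
    _ = 2 * tailNorm (seqDyadic c) J ^ 2 := by rw [ENNReal.tsum_mul_left, tailNorm_sq]

theorem tsum_sq_le_tailNorm_seqDyadic (c : ι → ℂ) :
    ∑' n, ‖c n‖ₑ ^ 2 ≤ 2 * tailNorm (seqDyadic c) 0 ^ 2 := by
  have := tsum_notMem_upperLevel_sq_le c 0
  rw [upperLevel_zero] at this
  simpa using ((Equiv.subtypeUnivEquiv (p := (· ∉ (∅ : Finset ι)))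
    Finset.notMem_empty).tsum_eq fun n => ‖c n‖ₑ ^ 2).symm.trans_le this

theorem sum_upperLevel_sq_le (c : ι → ℂ) (J : ℕ) :
    (∑ n ∈ upperLevel c J, ‖c n‖ₑ) ^ 2 ≤
      2 * ((2 ^ J - 1 : ℕ) : ℝ≥0∞) * tailNorm (seqDyadic c) 0 ^ 2 := by
  calc (∑ n ∈ upperLevel c J, ‖c n‖ₑ) ^ 2
      ≤ (upperLevel c J).card * ∑ n ∈ upperLevel c J, ‖c n‖ₑ ^ 2 := by
        have cauchy_schwarz := ENNReal.rpow_sum_le_const_mul_sum_rpow (upperLevel c J)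
          (fun n => ‖c n‖ₑ) (one_le_two : (1 : ℝ) ≤ 2)
        norm_num at cauchy_schwarz
        exact cauchy_schwarz
    _ ≤ ((2 ^ J - 1 : ℕ) : ℝ≥0∞) * (2 * tailNorm (seqDyadic c) 0 ^ 2) :=
        mul_le_mul' (mod_cast card_upperLevel_le J)
          ((ENNReal.sum_le_tsum _).trans (tsum_sq_le_tailNorm_seqDyadic c))
    _ = _ := by ring

end UpperLevels

section DyadicLayerCake

theorem funRearr_le_add {f g : ℝ → ℂ} {Q : ℝ≥0∞} (h : ∀ᵐ x ∂volI, ‖f x‖ₑ ≤ ‖g x‖ₑ + Q) (t : ℝ) :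
    funRearr f t ≤ funRearr g t + Q := by
  rw [funRearr, funRearr, ENNReal.sInf_add]
  refine le_iInf₂ fun s hs => sInf_le ((measure_mono_ae ?_).trans hs)
  filter_upwards [h] with x hx (hsx : s + Q < ‖f x‖ₑ)
  exact lt_of_add_lt_add_right (hsx.trans_le hx)

theorem lt_volI_of_lt_funRearr_sq {g : ℝ → ℂ} {s t : ℝ} (ht : 0 ≤ t)
    (h : ENNReal.ofReal t < funRearr g s ^ 2) :
    ENNReal.ofReal s < volI {x | t < ‖g x‖ ^ 2} := by
  rw [← ennreal_rpow_half_sq (ENNReal.ofReal t), ENNReal.pow_lt_pow_left_iff two_ne_zero] at h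
  have level := notMem_of_lt_csInf h (OrderBot.bddBelow _)
  rw [mem_ofPred_eq, not_le] at level
  refine level.trans_le (measure_mono fun x (hx : _ < ‖g x‖ₑ) => ?_)
  rwa [← ENNReal.pow_lt_pow_left_iff two_ne_zero, ennreal_rpow_half_sq, ← ofReal_norm,
    ← ENNReal.ofReal_pow (norm_nonneg _), ENNReal.ofReal_lt_ofReal_iff_of_nonneg ht] at hx

theorem tsum_indicator_half_pow_lt_le (D : ℝ≥0∞) :
    ∑' i : ℕ, {i : ℕ | (2⁻¹ : ℝ≥0∞) ^ i < D}.indicator (fun i => 2⁻¹ ^ i) i ≤ 2 * D := by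
  classical
  set A := {i : ℕ | (2⁻¹ : ℝ≥0∞) ^ i < D}
  by_cases hA : ∃ i, i ∈ A
  · set m := Nat.find hA
    have support_subset : Function.support (A.indicator fun i => (2⁻¹ : ℝ≥0∞) ^ i) ⊆
        range (m + ·) := fun i hi =>
      (Nat.exists_eq_add_of_le (Nat.find_min' hA (mem_of_indicator_ne_zero hi))).imp
        fun _ => Eq.symm
    calc _ = ∑' d : ℕ, A.indicator (fun i => (2⁻¹ : ℝ≥0∞) ^ i) (m + d) :=
          ((add_right_injective m).tsum_eq support_subset).symm
      _ ≤ ∑' d : ℕ, (2⁻¹ : ℝ≥0∞) ^ m * 2⁻¹ ^ d := by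
          simp_rw [← pow_add]
          exact ENNReal.tsum_le_tsum fun d => indicator_le_self' (fun _ _ => zero_le) _
      _ = 2 * (2⁻¹ : ℝ≥0∞) ^ m := by
          rw [ENNReal.tsum_mul_left, ENNReal.tsum_geometric, ENNReal.one_sub_inv_two, inv_inv,
            mul_comm]
      _ ≤ 2 * D := mul_le_mul_right (Nat.find_spec hA).le _
  · simp [eq_empty_iff_forall_notMem.2 (not_exists.1 hA)]

theorem volume_restrict_Ioi_ofReal_lt (y : ℝ≥0∞) :
    volume.restrict (Ioi 0) {t : ℝ | ENNReal.ofReal t < y} = y := by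
  rw [Measure.restrict_apply (measurableSet_lt ENNReal.measurable_ofReal measurable_const)]
  rcases eq_or_ne y ∞ with rfl | hy
  · simp
  · have : {t : ℝ | ENNReal.ofReal t < y} ∩ Ioi 0 = Ioo 0 y.toReal := by
      ext t
      simp +contextual [and_comm, ENNReal.ofReal_lt_iff_lt_toReal, hy, le_of_lt]
    simp [this, hy]

theorem two_rpow_neg_half_mul_sq (j : ℕ) : ((2 : ℝ≥0∞) ^ (-(1 / 2 : ℝ) * j)) ^ 2 = 2⁻¹ ^ j := by
  rw [neg_mul, ENNReal.rpow_neg, ← ENNReal.inv_pow, mul_comm, ENNReal.rpow_natCast_mul,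
    ennreal_rpow_half_sq, ENNReal.inv_pow]

theorem funDyadic_sq (f : ℝ → ℂ) (j : ℕ) :
    funDyadic f j ^ 2 = 2⁻¹ ^ j * funRearr f ((1 / 2) ^ j) ^ 2 := by
  rw [funDyadic, mul_pow, two_rpow_neg_half_mul_sq]

theorem eLpNorm_two_sq {X E : Type*} [MeasurableSpace X] [NormedAddCommGroup E] (μ : Measure X)
    (g : X → E) : eLpNorm g 2 μ ^ 2 = ∫⁻ x, ‖g x‖ₑ ^ 2 ∂μ := by
  simpa using eLpNorm_nnreal_pow_eq_lintegral (p := 2) (f := g) (μ := μ) two_ne_zero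

theorem ofReal_half_pow (i : ℕ) : ENNReal.ofReal ((1 / 2) ^ i) = 2⁻¹ ^ i := by
  rw [ENNReal.ofReal_pow (by positivity), one_div, ENNReal.ofReal_inv_of_pos two_pos,
    ENNReal.ofReal_ofNat]

/-- Both sides are integrated over the levels `t` of `|g| ^ 2`: if `t` lies below `g^*(s) ^ 2`, then
`|g| ^ 2` exceeds `t` on a set of measure more than `s`. -/
theorem tsum_funDyadic_sq_le {g : ℝ → ℂ} (hg : AEStronglyMeasurable g volI) :
    ∑' i, funDyadic g i ^ 2 ≤ 2 * ∫⁻ x, ‖g x‖ₑ ^ 2 ∂volI := by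
  have layer_cake : ∫⁻ x, ‖g x‖ₑ ^ 2 ∂volI = ∫⁻ t in Ioi 0, volI {x | t < ‖g x‖ ^ 2} := by
    rw [← lintegral_eq_lintegral_meas_lt volI (.of_forall fun x => sq_nonneg ‖g x‖)
      (hg.norm.aemeasurable.pow_const 2)]
    simp_rw [ENNReal.ofReal_pow (norm_nonneg _), ofReal_norm]
  set S : ℕ → Set ℝ := fun i => {t | ENNReal.ofReal t < funRearr g ((1 / 2) ^ i) ^ 2}
  have measurable_S (i : ℕ) : MeasurableSet (S i) :=
    measurableSet_lt ENNReal.measurable_ofReal measurable_const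
  calc ∑' i, funDyadic g i ^ 2
      = ∑' i, ∫⁻ t in Ioi 0, (S i).indicator (fun _ => 2⁻¹ ^ i) t := by
        refine tsum_congr fun i => ?_
        rw [lintegral_indicator_const (measurable_S i), volume_restrict_Ioi_ofReal_lt,
          funDyadic_sq]
    _ = ∫⁻ t in Ioi 0, ∑' i, (S i).indicator (fun _ => 2⁻¹ ^ i) t :=
        (lintegral_tsum fun i => (measurable_const.indicator (measurable_S i)).aemeasurable).symm
    _ ≤ ∫⁻ t in Ioi 0, 2 * volI {x | t < ‖g x‖ ^ 2} := by
        refine setLIntegral_mono' measurableSet_Ioi fun t ht =>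
          (ENNReal.tsum_le_tsum fun i => ?_).trans (tsum_indicator_half_pow_lt_le _)
        by_cases hti : t ∈ S i
        · have level := lt_volI_of_lt_funRearr_sq (le_of_lt ht) hti
          rw [ofReal_half_pow] at level
          rw [indicator_of_mem hti, indicator_of_mem (mem_ofPred_eq ▸ level)]
        · rw [indicator_of_notMem hti]
          exact zero_le
    _ = 2 * ∫⁻ x, ‖g x‖ₑ ^ 2 ∂volI := by
        rw [layer_cake, lintegral_const_mul' _ _ ENNReal.ofNat_ne_top]

theorem tailNorm_funDyadic_le {g : ℝ → ℂ} (hg : AEStronglyMeasurable g volI) (j : ℕ) :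
    tailNorm (funDyadic g) j ≤ 2 ^ (1 / 2 : ℝ) * eLpNorm g 2 volI := by
  rw [← ENNReal.pow_le_pow_left_iff two_ne_zero, mul_pow, ennreal_rpow_half_sq, eLpNorm_two_sq,
    tailNorm_sq]
  exact (ENNReal.tsum_comp_le_tsum_of_injective (add_right_injective j) _).trans
    (tsum_funDyadic_sq_le hg)

theorem tailNorm_two_rpow_neg_half_mul (Q : ℝ≥0∞) (j : ℕ) :
    tailNorm (fun i : ℕ => 2 ^ (-(1 / 2 : ℝ) * i) * Q) j =
      2 ^ (1 / 2 : ℝ) * (2 ^ (-(1 / 2 : ℝ) * j) * Q) := by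
  refine (ENNReal.pow_right_strictMono two_ne_zero).injective ?_
  simp only [tailNorm_sq, mul_pow, two_rpow_neg_half_mul_sq, pow_add, ennreal_rpow_half_sq]
  rw [ENNReal.tsum_mul_right, ENNReal.tsum_mul_left, ENNReal.tsum_geometric,
    ENNReal.one_sub_inv_two, inv_inv]
  ring

theorem tailNorm_funDyadic_le_of_le_add {f g : ℝ → ℂ} (hg : AEStronglyMeasurable g volI)
    {Q : ℝ≥0∞} (h : ∀ᵐ x ∂volI, ‖f x‖ₑ ≤ ‖g x‖ₑ + Q) (j : ℕ) :
    tailNorm (funDyadic f) j ≤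
      2 ^ (1 / 2 : ℝ) * (eLpNorm g 2 volI + 2 ^ (-(1 / 2 : ℝ) * j) * Q) := by
  calc tailNorm (funDyadic f) j
      ≤ tailNorm (funDyadic g + fun i : ℕ => 2 ^ (-(1 / 2 : ℝ) * i) * Q) j := by
        refine eLpNorm_mono_enorm fun i => ?_
        simp only [enorm_eq_self, Pi.add_apply, funDyadic, ← mul_add]
        gcongr
        exact funRearr_le_add h _
    _ ≤ tailNorm (funDyadic g) j + tailNorm (fun i : ℕ => 2 ^ (-(1 / 2 : ℝ) * i) * Q) j :=
        eLpNorm_add_le Measurable.of_discrete.aestronglyMeasurable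
          Measurable.of_discrete.aestronglyMeasurable one_le_two
    _ ≤ 2 ^ (1 / 2 : ℝ) * eLpNorm g 2 volI + 2 ^ (1 / 2 : ℝ) * (2 ^ (-(1 / 2 : ℝ) * j) * Q) :=
        add_le_add (tailNorm_funDyadic_le hg j) (tailNorm_two_rpow_neg_half_mul Q j).le
    _ = _ := (mul_add _ _ _).symm

end DyadicLayerCake

section OrthonormalSeries

variable {ι : Type*}

section Hilbert

variable {𝕜 E : Type*} [RCLike 𝕜] [NormedAddCommGroup E] [InnerProductSpace 𝕜 E] {φ : ι → E}

theorem summable_smul_of_orthonormal [CompleteSpace E] (hφ : Orthonormal 𝕜 φ) {b : ι → 𝕜}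
    (hb : ∑' n, ‖b n‖ₑ ^ 2 ≠ ∞) : Summable fun n => b n • φ n := by
  have square_summable : Summable fun n => ‖b n‖ ^ 2 := by simpa using ENNReal.summable_toReal hb
  simpa using (hφ.orthogonalFamily.summable_iff_norm_sq_summable b).2 (by simpa)

theorem enorm_tsum_smul_sq_le_of_orthonormal (hφ : Orthonormal 𝕜 φ) (b : ι → 𝕜) :
    ‖∑' n, b n • φ n‖ₑ ^ 2 ≤ ∑' n, ‖b n‖ₑ ^ 2 := by
  by_cases hsum : Summable fun n => b n • φ n
  · have pythagoras (s : Finset ι) : ‖∑ n ∈ s, b n • φ n‖ₑ ^ 2 = ∑ n ∈ s, ‖b n‖ₑ ^ 2 := by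
      have := hφ.orthogonalFamily.norm_sum b s
      simp only [LinearIsometry.toSpanSingleton_apply] at this
      simp_rw [← ofReal_norm, ← ENNReal.ofReal_pow (norm_nonneg _)]
      rw [this, ENNReal.ofReal_sum_of_nonneg fun _ _ => by positivity]
    refine le_of_tendsto' (((ENNReal.continuous_pow 2).comp continuous_enorm).tendsto _ |>.comp
      hsum.hasSum) fun s => ?_
    exact (pythagoras s).trans_le (ENNReal.sum_le_tsum s)
  · simp [tsum_eq_zero_of_not_summable hsum]

end Hilbert

theorem ae_enorm_sum_smul_le {X 𝕜 E : Type*} [MeasurableSpace X] {μ : Measure X} {p : ℝ≥0∞}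
    [NormedField 𝕜] [NormedAddCommGroup E] [NormedSpace 𝕜 E] {φ : ι → Lp E p μ} {M : ℝ≥0∞}
    (hM : ∀ n, eLpNorm (φ n) ∞ μ ≤ M) (b : ι → 𝕜) (s : Finset ι) :
    ∀ᵐ x ∂μ, ‖(∑ n ∈ s, b n • φ n : Lp E p μ) x‖ₑ ≤ M * ∑ n ∈ s, ‖b n‖ₑ := by
  have terms : ∀ᵐ x ∂μ, ∀ n ∈ s, ‖(b n • φ n : Lp E p μ) x‖ₑ ≤ ‖b n‖ₑ * M := by
    refine (Finset.eventually_all s).2 fun n _ => ?_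
    filter_upwards [Lp.coeFn_smul (b n) (φ n), enorm_ae_le_eLpNormEssSup (φ n) μ] with x hx hφ
    rw [hx, Pi.smul_apply, enorm_smul]
    gcongr
    exact hφ.trans (by simpa using hM n)
  filter_upwards [terms, Lp.coeFn_finsetSum s fun n => b n • φ n] with x hx hsum
  rw [hsum, mul_comm, Finset.sum_mul]
  simpa using (enorm_sum_le s fun n => (b n • φ n : Lp E p μ) x).trans (Finset.sum_le_sum hx)

variable {φ : ι → Lp ℂ 2 volI} {M : ℝ≥0∞} {c : ι → ℂ}

theorem summable_of_tailNorm_seqDyadic_ne_top (hφ : Orthonormal ℂ φ)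
    (hc : tailNorm (seqDyadic c) 0 ≠ ∞) : Summable fun n => c n • φ n :=
  summable_smul_of_orthonormal hφ (ne_top_of_le_ne_top (by finiteness)
    (tsum_sq_le_tailNorm_seqDyadic c))

/-- The terms above the level `c^*_{2 ^ J}` are estimated in `L_∞`, the others in `L_2`. -/
theorem tailNorm_funDyadic_invFourier_le (hφ : Orthonormal ℂ φ)
    (hM : ∀ n, eLpNorm (φ n) ∞ volI ≤ M) (hc : tailNorm (seqDyadic c) 0 ≠ ∞) (J j : ℕ) :
    tailNorm (funDyadic (invFourier φ c)) j ≤ 2 * (tailNorm (seqDyadic c) J +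
      M * (2 ^ (-(1 / 2 : ℝ) * j) * ((2 ^ J - 1 : ℕ) : ℝ≥0∞) ^ (1 / 2 : ℝ)) *
        tailNorm (seqDyadic c) 0) := by
  set large := ∑ n ∈ upperLevel c J, c n • φ n
  set small := ∑' n : {n // n ∉ upperLevel c J}, c n • φ n
  have split : invFourier φ c = small + large := by
    rw [add_comm]
    exact ((summable_of_tailNorm_seqDyadic_ne_top hφ hc).sum_add_tsum_subtype_compl _).symm
  have small_le : eLpNorm small 2 volI ≤ 2 ^ (1 / 2 : ℝ) * tailNorm (seqDyadic c) J := by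
    rw [← Lp.enorm_def, ← ENNReal.pow_le_pow_left_iff two_ne_zero, mul_pow, ennreal_rpow_half_sq]
    exact (enorm_tsum_smul_sq_le_of_orthonormal (hφ.comp _ Subtype.val_injective) _).trans
      (tsum_notMem_upperLevel_sq_le c J)
  have large_le : ∑ n ∈ upperLevel c J, ‖c n‖ₑ ≤ 2 ^ (1 / 2 : ℝ) *
      ((2 ^ J - 1 : ℕ) : ℝ≥0∞) ^ (1 / 2 : ℝ) * tailNorm (seqDyadic c) 0 := by
    rw [← ENNReal.pow_le_pow_left_iff two_ne_zero, mul_pow, mul_pow, ennreal_rpow_half_sq,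
      ennreal_rpow_half_sq]
    exact sum_upperLevel_sq_le c J
  have pointwise : ∀ᵐ x ∂volI, ‖invFourier φ c x‖ₑ ≤
      ‖small x‖ₑ + M * ∑ n ∈ upperLevel c J, ‖c n‖ₑ := by
    filter_upwards [ae_enorm_sum_smul_le hM c (upperLevel c J), Lp.coeFn_add small large]
      with x hlarge hadd
    rw [split, hadd, Pi.add_apply]
    exact (enorm_add_le _ _).trans (add_le_add_right hlarge _)
  have half_add_half : (2 : ℝ≥0∞) ^ (1 / 2 : ℝ) * 2 ^ (1 / 2 : ℝ) = 2 := by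
    rw [← sq, ennreal_rpow_half_sq]
  calc _ ≤ 2 ^ (1 / 2 : ℝ) * (eLpNorm small 2 volI +
          2 ^ (-(1 / 2 : ℝ) * j) * (M * ∑ n ∈ upperLevel c J, ‖c n‖ₑ)) :=
        tailNorm_funDyadic_le_of_le_add (Lp.aestronglyMeasurable small) pointwise j
    _ ≤ 2 ^ (1 / 2 : ℝ) * (2 ^ (1 / 2 : ℝ) * tailNorm (seqDyadic c) J + 2 ^ (-(1 / 2 : ℝ) * j) *
          (M * (2 ^ (1 / 2 : ℝ) * ((2 ^ J - 1 : ℕ) : ℝ≥0∞) ^ (1 / 2 : ℝ) *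
            tailNorm (seqDyadic c) 0))) := by gcongr
    _ = 2 ^ (1 / 2 : ℝ) * 2 ^ (1 / 2 : ℝ) * (tailNorm (seqDyadic c) J +
          M * (2 ^ (-(1 / 2 : ℝ) * j) * ((2 ^ J - 1 : ℕ) : ℝ≥0∞) ^ (1 / 2 : ℝ)) *
            tailNorm (seqDyadic c) 0) := by ring
    _ = _ := by rw [half_add_half]

theorem two_rpow_mul_sqrt_le (l : ℕ) :
    2 ^ (-(1 / 2 : ℝ) * (2 ^ l - 1 : ℕ)) * ((2 ^ (2 ^ (l - 1) - 1) - 1 : ℕ) : ℝ≥0∞) ^ (1 / 2 : ℝ) ≤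
      2 ^ (-(1 / 4 : ℝ) * (2 ^ l : ℕ)) := by
  cases l with
  | zero => simp
  | succ m =>
    rw [Nat.add_sub_cancel]
    have sqrt_le : ((2 ^ (2 ^ m - 1) - 1 : ℕ) : ℝ≥0∞) ^ (1 / 2 : ℝ) ≤
        2 ^ ((1 / 2 : ℝ) * (2 ^ m - 1 : ℕ)) := by
      rw [mul_comm, ENNReal.rpow_natCast_mul]
      exact ENNReal.rpow_le_rpow (mod_cast Nat.sub_le _ _) (by positivity)
    refine (mul_le_mul_right sqrt_le _).trans_eq ?_
    rw [← two_rpow_add]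
    congr 1
    push_cast [Nat.one_le_two_pow]
    ring

theorem blockNorm_funDyadic_invFourier_le (hφ : Orthonormal ℂ φ)
    (hM : ∀ n, eLpNorm (φ n) ∞ volI ≤ M) (hc : tailNorm (seqDyadic c) 0 ≠ ∞) (l : ℕ) :
    blockNorm (funDyadic (invFourier φ c)) l ≤
      2 * (tailNorm (blockNorm (seqDyadic c)) (l - 1) +
        min 1 (M * 2 ^ (-(1 / 4 : ℝ) * (2 ^ l : ℕ))) *
          tailNorm (blockNorm (seqDyadic c)) 0) := by
  set T := tailNorm (blockNorm (seqDyadic c))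
  have T_eq (m : ℕ) : tailNorm (seqDyadic c) (2 ^ m - 1) = T m := (tailNorm_blockNorm _ m).symm
  have T_zero : tailNorm (seqDyadic c) 0 = T 0 := T_eq 0
  have without_splitting : blockNorm (funDyadic (invFourier φ c)) l ≤ 2 * T 0 := by
    refine (blockNorm_le_tailNorm _ l).trans ?_
    simpa [T_zero] using tailNorm_funDyadic_invFourier_le hφ hM hc 0 (2 ^ l - 1)
  have with_splitting : blockNorm (funDyadic (invFourier φ c)) l ≤
      2 * (T (l - 1) + M * 2 ^ (-(1 / 4 : ℝ) * (2 ^ l : ℕ)) * T 0) := by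
    refine (blockNorm_le_tailNorm _ l).trans
      ((tailNorm_funDyadic_invFourier_le hφ hM hc (2 ^ (l - 1) - 1) (2 ^ l - 1)).trans ?_)
    rw [T_eq, T_zero]
    gcongr
    exact two_rpow_mul_sqrt_le l
  rcases min_choice 1 (M * 2 ^ (-(1 / 4 : ℝ) * (2 ^ l : ℕ))) with h | h <;> rw [h]
  · rw [one_mul]
    exact without_splitting.trans (mul_le_mul_right le_add_self _)
  · exact with_splitting

end OrthonormalSeries

theorem rpow_le_rpow_self_mul_exp {x s : ℝ} (hx : 0 ≤ x) (hs : 0 < s) :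
    x ^ s ≤ s ^ s * Real.exp x := by
  have h : x / s ≤ Real.exp (x / s) := by linarith [Real.add_one_le_exp (x / s)]
  calc x ^ s = s ^ s * (x / s) ^ s := by
        rw [← Real.mul_rpow hs.le (by positivity), mul_div_cancel₀ _ hs.ne']
    _ ≤ s ^ s * Real.exp (x / s) ^ s := by gcongr
    _ = s ^ s * Real.exp x := by rw [← Real.exp_mul, div_mul_cancel₀ _ hs.ne']

theorem min_one_exp_le {a L : ℝ} (hL : 1 ≤ L) : min 1 (Real.exp a) ≤ Real.exp (a / L) := by
  rcases le_total a 0 with ha | ha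
  · refine min_le_of_right_le (Real.exp_le_exp.2 ?_)
    rw [le_div_iff₀ (by linarith)]
    nlinarith
  · exact min_le_of_left_le (Real.one_le_exp (by positivity))

theorem min_one_mul_two_rpow_neg_le {s : ℝ} (hs : 0 < s) :
    ∃ C : ℝ, ∀ M : ℝ, 1 ≤ M → ∀ x : ℝ, 0 < x →
      min 1 (M * 2 ^ (-x)) ≤ C * min 1 (((1 + Real.log M) / x) ^ s) := by
  set K : ℝ := Real.exp 1 * (s ^ s * (Real.log 2 ^ s)⁻¹) with hK
  refine ⟨max 1 K, fun M hM x hx => ?_⟩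
  have log_two_pos : 0 < Real.log 2 := Real.log_pos one_lt_two
  have one_le_L : 1 ≤ 1 + Real.log M := by linarith [Real.log_nonneg hM]
  generalize hL : 1 + Real.log M = L at one_le_L ⊢
  have decay : min 1 (M * 2 ^ (-x)) ≤ K * (L / x) ^ s := by
    set y := Real.log 2 * (x / L) with hy
    have y_pos : 0 < y := by positivity
    calc min 1 (M * 2 ^ (-x)) = min 1 (Real.exp (Real.log M - x * Real.log 2)) := by
          rw [Real.exp_sub, Real.exp_log (by linarith), mul_comm x, Real.exp_mul,
            Real.exp_log two_pos, Real.rpow_neg two_pos.le, div_eq_mul_inv]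
      _ ≤ Real.exp ((Real.log M - x * Real.log 2) / L) := min_one_exp_le one_le_L
      _ ≤ Real.exp (1 - y) := by
          refine Real.exp_le_exp.2 ?_
          rw [div_le_iff₀ (by linarith), sub_mul, hy, mul_assoc, div_mul_cancel₀ _ (by linarith)]
          linarith
      _ = Real.exp 1 * (Real.exp y)⁻¹ := by rw [sub_eq_add_neg, Real.exp_add, Real.exp_neg]
      _ ≤ Real.exp 1 * (s ^ s * (y ^ s)⁻¹) := by
          gcongr
          rw [← div_eq_mul_inv, le_div_iff₀ (by positivity), inv_mul_le_iff₀ (Real.exp_pos y),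
            mul_comm]
          exact rpow_le_rpow_self_mul_exp y_pos.le hs
      _ = K * (L / x) ^ s := by
          rw [hy, Real.mul_rpow log_two_pos.le (by positivity), mul_inv,
            ← Real.inv_rpow (by positivity : 0 ≤ x / L), inv_div, hK]
          ring
  rw [mul_min_of_nonneg _ _ (by positivity), mul_one]
  exact le_min ((min_le_left _ _).trans (le_max_left _ _))
    (decay.trans (mul_le_mul_of_nonneg_right (le_max_right _ _) (by positivity)))

theorem rpow_mul_min_one_div_rpow {u L : ℝ} (hu : 0 < u) (hL : 0 < L) (δ : ℝ) :
    u ^ δ * min 1 ((L / u) ^ (2 * δ)) = L ^ δ * min ((u / L) ^ δ) ((L / u) ^ δ) := by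
  rw [mul_min_of_nonneg _ _ (by positivity), mul_min_of_nonneg _ _ (by positivity),
    two_mul, Real.rpow_add (by positivity), Real.div_rpow hu.le hL.le, Real.div_rpow hL.le hu.le]
  congr 1 <;> field_simp

theorem min_div_two_pow_le {L : ℝ} {n : ℕ} (hn : (2 : ℝ) ^ n ≤ L) (hn' : L < 2 ^ (n + 1)) (l : ℕ) :
    min (2 ^ l / L) (L / 2 ^ l) ≤ 2 * 2⁻¹ ^ ((l : ℤ) - n).natAbs := by
  have L_pos : 0 < L := lt_of_lt_of_le (by positivity) hn
  rcases le_total n l with h | h <;> obtain ⟨d, rfl⟩ := Nat.exists_eq_add_of_le h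
  · refine min_le_of_right_le ?_
    have : ((n + d : ℕ) - n : ℤ).natAbs = d := by lia
    rw [this, inv_pow, ← div_eq_mul_inv, div_le_div_iff₀ (by positivity) (by positivity)]
    calc L * 2 ^ d ≤ 2 ^ (n + 1) * 2 ^ d := by gcongr
      _ = 2 * 2 ^ (n + d) := by ring
  · refine min_le_of_left_le ?_
    have : ((l : ℤ) - (l + d : ℕ)).natAbs = d := by lia
    rw [this, inv_pow, ← div_eq_mul_inv, div_le_div_iff₀ (by positivity) (by positivity)]
    calc (2 : ℝ) ^ l * 2 ^ d = 2 ^ (l + d) := by ring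
      _ ≤ 2 * L := by linarith

theorem two_rpow_mul_min_one_le {δ L : ℝ} (hδ : 0 ≤ δ) {n : ℕ} (hn : 2 ^ n ≤ L)
    (hn' : L < 2 ^ (n + 1)) (l : ℕ) :
    2 ^ (δ * l) * min 1 ((L / 2 ^ l) ^ (2 * δ)) ≤
      2 ^ δ * L ^ δ * (2 ^ (-δ)) ^ ((l : ℤ) - n).natAbs := by
  have L_pos : 0 < L := lt_of_lt_of_le (by positivity) hn
  have balance := min_div_two_pow_le hn hn' l
  generalize ((l : ℤ) - n).natAbs = k at balance ⊢
  calc (2 : ℝ) ^ (δ * l) * min 1 ((L / 2 ^ l) ^ (2 * δ))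
      = L ^ δ * min ((2 ^ l / L) ^ δ) ((L / 2 ^ l) ^ δ) := by
        rw [mul_comm δ, Real.rpow_natCast_mul two_pos.le,
          rpow_mul_min_one_div_rpow (by positivity) L_pos]
    _ = L ^ δ * min (2 ^ l / L) (L / 2 ^ l) ^ δ := by
        rw [(Real.monotoneOn_rpow_Ici_of_exponent_nonneg hδ).map_min
          (mem_Ici.2 (by positivity)) (mem_Ici.2 (by positivity))]
    _ ≤ L ^ δ * (2 * 2⁻¹ ^ k) ^ δ := by gcongr
    _ = 2 ^ δ * L ^ δ * (2 ^ (-δ)) ^ k := by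
        rw [Real.mul_rpow two_pos.le (by positivity), Real.rpow_neg two_pos.le,
          ← Real.inv_rpow two_pos.le, ← Real.rpow_pow_comm (by positivity)]
        ring

theorem eLpNorm_two_rpow_mul_min_one_le {δ : ℝ} (hδ : 0 < δ) {q : ℝ≥0∞} (hq : q ≠ 0) :
    ∃ C : ℝ≥0∞, C ≠ ∞ ∧ ∀ L : ℝ, 1 ≤ L →
      eLpNorm (fun l : ℕ => ENNReal.ofReal (2 ^ (δ * l) * min 1 ((L / 2 ^ l) ^ (2 * δ)))) q
        Measure.count ≤ C * ENNReal.ofReal (L ^ δ) := by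
  set r : ℝ≥0∞ := 2 ^ (-δ) with hr
  refine ⟨2 ^ δ * eLpNorm (fun k : ℤ => r ^ k.natAbs) q Measure.count,
    ENNReal.mul_ne_top (two_rpow_ne_top δ)
      (eLpNorm_geometric_int_ne_top (two_rpow_neg_lt_one hδ) hq), fun L hL => ?_⟩
  obtain ⟨n, hn, hn'⟩ := exists_nat_pow_near hL one_lt_two
  have pointwise (l : ℕ) : ENNReal.ofReal (2 ^ (δ * l) * min 1 ((L / 2 ^ l) ^ (2 * δ))) ≤
      2 ^ δ * ENNReal.ofReal (L ^ δ) * r ^ ((l : ℤ) - n).natAbs := by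
    refine (ENNReal.ofReal_le_ofReal (two_rpow_mul_min_one_le hδ.le hn hn' l)).trans_eq ?_
    rw [ENNReal.ofReal_mul (by positivity), ENNReal.ofReal_mul (by positivity),
      ENNReal.ofReal_pow (by positivity), ← ENNReal.ofReal_rpow_of_pos two_pos,
      ← ENNReal.ofReal_rpow_of_pos two_pos, ENNReal.ofReal_ofNat, hr]
  calc _ ≤ 2 ^ δ * ENNReal.ofReal (L ^ δ) *
          eLpNorm (fun l : ℕ => r ^ ((l : ℤ) - n).natAbs) q Measure.count :=
        eLpNorm_le_const_mul_of_discrete q pointwise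
    _ ≤ 2 ^ δ * ENNReal.ofReal (L ^ δ) *
          eLpNorm (fun k : ℤ => r ^ k.natAbs) q Measure.count :=
        mul_le_mul_right (eLpNorm_count_comp_le (σ := fun l : ℕ => (l : ℤ) - n)
          (fun a b h => by simpa using h) (fun k => r ^ k.natAbs) q) _
    _ = _ := mul_right_comm _ _ _

theorem one_add_log_rpow_le_mul_min {δ γ : ℝ} (hδ : 0 < δ) (hγ : δ ≤ γ) :
    ∃ C : ℝ, ∀ M : ℝ, 1 ≤ M →
      (1 + Real.log M) ^ δ ≤ C * min M ((1 + Real.log M) ^ γ) := by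
  refine ⟨max (δ ^ δ * Real.exp 1) 1, fun M hM => ?_⟩
  have one_le_L : 1 ≤ 1 + Real.log M := by linarith [Real.log_nonneg hM]
  rw [mul_min_of_nonneg _ _ (by positivity)]
  refine le_min ?_ ?_
  · calc (1 + Real.log M) ^ δ ≤ δ ^ δ * Real.exp (1 + Real.log M) :=
          rpow_le_rpow_self_mul_exp (by linarith) hδ
      _ = δ ^ δ * Real.exp 1 * M := by rw [Real.exp_add, Real.exp_log (by linarith), mul_assoc]
      _ ≤ max (δ ^ δ * Real.exp 1) 1 * M := by gcongr; exact le_max_left _ _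
  · exact (Real.rpow_le_rpow_of_exponent_le one_le_L hγ).trans
      (le_mul_of_one_le_left (by positivity) (le_max_right _ _))

theorem eLpNorm_weighted_exp_tail_le {δ γ : ℝ} (hδ : 0 < δ) (hγ : δ ≤ γ) {q : ℝ≥0∞} (hq : q ≠ 0) :
    ∃ C : ℝ≥0∞, C ≠ ∞ ∧ ∀ M : ℝ, 1 ≤ M →
      eLpNorm (fun l : ℕ => (2 : ℝ≥0∞) ^ (δ * l) *
          min 1 (ENNReal.ofReal M * 2 ^ (-(1 / 4 : ℝ) * (2 ^ l : ℕ)))) q Measure.count ≤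
        C * ENNReal.ofReal (min M ((1 + Real.log M) ^ γ)) := by
  obtain ⟨C₁, hC₁⟩ := min_one_mul_two_rpow_neg_le (by positivity : 0 < 2 * δ)
  obtain ⟨C₂, hC₂, norm_le⟩ := eLpNorm_two_rpow_mul_min_one_le hδ hq
  obtain ⟨C₃, hC₃⟩ := one_add_log_rpow_le_mul_min hδ hγ
  refine ⟨ENNReal.ofReal C₁ * C₂ * ENNReal.ofReal (4 ^ δ) * ENNReal.ofReal C₃, by finiteness,
    fun M hM => ?_⟩
  have one_le_L : 1 ≤ 1 + Real.log M := by linarith [Real.log_nonneg hM]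
  have pointwise (l : ℕ) : (2 : ℝ≥0∞) ^ (δ * l) *
      min 1 (ENNReal.ofReal M * 2 ^ (-(1 / 4 : ℝ) * (2 ^ l : ℕ))) ≤ ENNReal.ofReal C₁ *
        ENNReal.ofReal (2 ^ (δ * l) * min 1 ((4 * (1 + Real.log M) / 2 ^ l) ^ (2 * δ))) := by
    have real_bound := hC₁ M hM ((1 / 4 : ℝ) * (2 ^ l : ℕ)) (by positivity)
    have scale : (1 + Real.log M) / ((1 / 4 : ℝ) * (2 ^ l : ℕ)) =
        4 * (1 + Real.log M) / 2 ^ l := by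
      push_cast
      field_simp
    rw [scale] at real_bound
    have two_rpow (x : ℝ) : (2 : ℝ≥0∞) ^ x = ENNReal.ofReal (2 ^ x) := by
      rw [← ENNReal.ofReal_rpow_of_pos two_pos, ENNReal.ofReal_ofNat]
    rw [two_rpow, two_rpow, ← ENNReal.ofReal_mul (by linarith), ← ENNReal.ofReal_one,
      ← ENNReal.ofReal_min, ENNReal.ofReal_mul (by positivity), mul_left_comm, neg_mul]
    refine mul_le_mul_right ?_ _
    rw [← ENNReal.ofReal_mul' (by positivity)]
    exact ENNReal.ofReal_le_ofReal real_bound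
  calc _ ≤ ENNReal.ofReal C₁ * (C₂ * ENNReal.ofReal ((4 * (1 + Real.log M)) ^ δ)) :=
        (eLpNorm_le_const_mul_of_discrete q pointwise).trans
          (mul_le_mul_right (norm_le _ (by linarith)) _)
    _ = ENNReal.ofReal C₁ * C₂ * ENNReal.ofReal (4 ^ δ) *
          ENNReal.ofReal ((1 + Real.log M) ^ δ) := by
        rw [Real.mul_rpow (by norm_num) (by linarith), ENNReal.ofReal_mul (by positivity)]
        ring
    _ ≤ ENNReal.ofReal C₁ * C₂ * ENNReal.ofReal (4 ^ δ) *
          (ENNReal.ofReal C₃ * ENNReal.ofReal (min M ((1 + Real.log M) ^ γ))) := by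
        rw [← ENNReal.ofReal_mul' (by positivity)]
        gcongr
        exact hC₃ M hM
    _ = _ := by ring

theorem one_le_of_orthonormal {ι X 𝕜 E : Type*} [Nonempty ι] [MeasurableSpace X] {μ : Measure X}
    [IsProbabilityMeasure μ] [RCLike 𝕜] [NormedAddCommGroup E] [InnerProductSpace 𝕜 E]
    {φ : ι → Lp E 2 μ} {M : ℝ≥0∞} (hφ : Orthonormal 𝕜 φ) (hM : ∀ n, eLpNorm (φ n) ∞ μ ≤ M) :
    1 ≤ M := by
  obtain ⟨n⟩ := ‹Nonempty ι›
  calc 1 = eLpNorm (φ n) 2 μ := by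
        rw [← Lp.enorm_def, ← ofReal_norm, hφ.norm_eq_one n, ENNReal.ofReal_one]
    _ ≤ eLpNorm (φ n) ∞ μ :=
        eLpNorm_le_eLpNorm_of_exponent_le le_top (Lp.aestronglyMeasurable (φ n))
    _ ≤ M := hM n

instance : IsProbabilityMeasure volI := ⟨by simp⟩

theorem recip_min_add_recip_max (q r : ℝ≥0∞) :
    recip (min q r) + recip (max q r) = recip q + recip r := by
  rcases le_total q r with h | h
  · rw [min_eq_left h, max_eq_right h]
  · rw [min_eq_right h, max_eq_left h, add_comm]

theorem eLpNorm_blockNorm_seqDyadic_le {q : ℝ≥0∞} (hq : q ≠ 0) (α : ℝ) :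
    ∃ C : ℝ≥0∞, C ≠ ∞ ∧ ∀ {ι : Type*} (c : ι → ℂ),
      eLpNorm (fun l : ℕ => (2 : ℝ≥0∞) ^ ((α + recip q) * l) * blockNorm (seqDyadic c) l) q
        Measure.count ≤ C * seqLZNorm 2 q (α + recip (min q 2)) c := by
  set b := α + recip (min q 2)
  have exponent : b - recip 2 + recip (max 2 q) = α + recip q := by
    linarith [max_comm 2 q ▸ recip_min_add_recip_max q 2]
  refine ⟨2 ^ |b| * 2 ^ (|recip 2 - recip q| + |b| + 2 * recip q),
    ENNReal.mul_ne_top (two_rpow_ne_top _) (two_rpow_ne_top _), fun c => ?_⟩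
  rw [← exponent, mul_assoc]
  exact (eLpNorm_blockNorm_le hq b _).trans (mul_le_mul_right (eLpNorm_seqDyadic_le hq b c) _)

theorem eLpNorm_tailNorm_seqDyadic_le {q : ℝ≥0∞} (hq : q ≠ 0) {α : ℝ} (hα : -recip q < α) :
    ∃ C : ℝ≥0∞, C ≠ ∞ ∧ ∀ {ι : Type*} (c : ι → ℂ),
      eLpNorm (fun l : ℕ => (2 : ℝ≥0∞) ^ ((α + recip q) * l) * tailNorm (blockNorm (seqDyadic c)) l)
        q Measure.count ≤ C * seqLZNorm 2 q (α + recip (min q 2)) c := by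
  obtain ⟨C₁, hC₁, hardy⟩ := eLpNorm_weighted_tailNorm_le (by linarith : 0 < α + recip q) hq
  obtain ⟨C₂, hC₂, block_le⟩ := eLpNorm_blockNorm_seqDyadic_le hq α
  refine ⟨C₁ * C₂, ENNReal.mul_ne_top hC₁ hC₂, fun c => ?_⟩
  rw [mul_assoc]
  exact (hardy _).trans (mul_le_mul_right (block_le c) _)

theorem tailNorm_seqDyadic_zero_le {q : ℝ≥0∞} (hq : q ≠ 0) (δ : ℝ) {ι : Type*} (c : ι → ℂ) :
    tailNorm (seqDyadic c) 0 ≤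
      eLpNorm (fun l : ℕ => (2 : ℝ≥0∞) ^ (δ * l) * tailNorm (blockNorm (seqDyadic c)) l) q
        Measure.count := by
  simpa [tailNorm_blockNorm] using enorm_le_eLpNorm_count
    (fun l : ℕ => (2 : ℝ≥0∞) ^ (δ * l) * tailNorm (blockNorm (seqDyadic c)) l) 0 hq

theorem funLZNorm_le_eLpNorm_blockNorm (q : ℝ≥0∞) (b : ℝ) :
    ∃ C : ℝ≥0∞, C ≠ ∞ ∧ ∀ f : ℝ → ℂ, funLZNorm 2 q b f ≤
      C * eLpNorm (fun l : ℕ => (2 : ℝ≥0∞) ^ ((b + recip q - recip (max q 2)) * l) *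
        blockNorm (funDyadic f) l) q Measure.count := by
  refine ⟨2 ^ (|recip 2 - recip q| + |b|) * 2 ^ |b|,
    ENNReal.mul_ne_top (two_rpow_ne_top _) (two_rpow_ne_top _), fun f => ?_⟩
  rw [mul_assoc]
  exact (funLZNorm_le_eLpNorm_funDyadic q b f).trans
    (mul_le_mul_right (eLpNorm_le_blockNorm q b _) _)

theorem max_funLZNorm_le_eLpNorm_blockNorm {q : ℝ≥0∞} (hq : q ≠ 0) (α : ℝ) :
    ∃ C : ℝ≥0∞, C ≠ ∞ ∧ ∀ f : ℝ → ℂ,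
      max (funLZNorm 2 q (α + recip (max q 2)) f) (funLZNorm 2 (max q 2) (α + recip q) f) ≤
        C * eLpNorm (fun l : ℕ => (2 : ℝ≥0∞) ^ ((α + recip q) * l) * blockNorm (funDyadic f) l) q
          Measure.count := by
  obtain ⟨C₁, hC₁, norm_q⟩ := funLZNorm_le_eLpNorm_blockNorm q (α + recip (max q 2))
  obtain ⟨C₂, hC₂, norm_max⟩ := funLZNorm_le_eLpNorm_blockNorm (max q 2) (α + recip q)
  have exponent : α + recip (max q 2) + recip q - recip (max q 2) = α + recip q := by ring
  have exponent_max : α + recip q + recip (max q 2) - recip (max (max q 2) 2) = α + recip q := by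
    rw [max_eq_left (le_max_right q 2), add_sub_cancel_right]
  rw [exponent] at norm_q
  rw [exponent_max] at norm_max
  refine ⟨max C₁ C₂, max_ne_top hC₁ hC₂, fun f => max_le ?_ ?_⟩
  · exact (norm_q f).trans (mul_le_mul_left (le_max_left _ _) _)
  · exact (norm_max f).trans (mul_le_mul' (le_max_right _ _)
      (eLpNorm_count_le_of_exponent_le hq (le_max_left q 2) _))

theorem eLpNorm_blockNorm_invFourier_le {q : ℝ≥0∞} {ι : Type*} {φ : ι → Lp ℂ 2 volI} {M : ℝ≥0∞}
    {c : ι → ℂ} (hφ : Orthonormal ℂ φ) (hM : ∀ n, eLpNorm (φ n) ∞ volI ≤ M)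
    (hc : tailNorm (seqDyadic c) 0 ≠ ∞) (δ : ℝ) :
    eLpNorm (fun l : ℕ => (2 : ℝ≥0∞) ^ (δ * l) * blockNorm (funDyadic (invFourier φ c)) l) q
        Measure.count ≤
      ENNReal.LpAddConst q * (2 * 2 ^ |δ| * 2 ^ recip q *
        eLpNorm (fun l : ℕ => (2 : ℝ≥0∞) ^ (δ * l) * tailNorm (blockNorm (seqDyadic c)) l) q
          Measure.count +
        2 * tailNorm (seqDyadic c) 0 * eLpNorm (fun l : ℕ => (2 : ℝ≥0∞) ^ (δ * l) *
          min 1 (M * 2 ^ (-(1 / 4 : ℝ) * (2 ^ l : ℕ)))) q Measure.count) := by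
  set T := tailNorm (blockNorm (seqDyadic c)) with hT
  have T_zero : T 0 = tailNorm (seqDyadic c) 0 := by
    simp only [hT, tailNorm_blockNorm, pow_zero, Nat.sub_self]
  set U : ℕ → ℝ≥0∞ := fun l => 2 ^ (δ * l) * T l with hU
  set W : ℕ → ℝ≥0∞ := fun l => 2 ^ (δ * l) * min 1 (M * 2 ^ (-(1 / 4 : ℝ) * (2 ^ l : ℕ))) with hW
  have pred_le (l : ℕ) : (2 : ℝ≥0∞) ^ (δ * l) * T (l - 1) ≤ 2 ^ |δ| * U (l - 1) := by
    rw [hU, ← mul_assoc, ← two_rpow_add]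
    gcongr
    · exact one_le_two
    · rcases l with _ | l
      · simp
      · push_cast
        linarith [le_abs_self δ]
  have pointwise (l : ℕ) : (2 : ℝ≥0∞) ^ (δ * l) * blockNorm (funDyadic (invFourier φ c)) l ≤
      2 * 2 ^ |δ| * U (l - 1) + 2 * T 0 * W l :=
    calc _ ≤ (2 : ℝ≥0∞) ^ (δ * l) *
          (2 * (T (l - 1) + min 1 (M * 2 ^ (-(1 / 4 : ℝ) * (2 ^ l : ℕ))) * T 0)) :=
          mul_le_mul_right (blockNorm_funDyadic_invFourier_le hφ hM hc l) _
      _ = 2 * (2 ^ (δ * l) * T (l - 1)) + 2 * T 0 * W l := by rw [hW]; ring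
      _ ≤ 2 * (2 ^ |δ| * U (l - 1)) + 2 * T 0 * W l := by grw [pred_le l]
      _ = _ := by rw [← mul_assoc 2 (2 ^ |δ|)]
  calc _ ≤ eLpNorm ((fun l => 2 * 2 ^ |δ| * U (l - 1)) + fun l => 2 * T 0 * W l) q
          Measure.count := eLpNorm_mono_enorm fun l => by
          simpa only [enorm_eq_self, Pi.add_apply] using pointwise l
    _ ≤ ENNReal.LpAddConst q * (eLpNorm (fun l => 2 * 2 ^ |δ| * U (l - 1)) q Measure.count +
          eLpNorm (fun l => 2 * T 0 * W l) q Measure.count) :=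
        eLpNorm_add_le' Measurable.of_discrete.aestronglyMeasurable
          Measurable.of_discrete.aestronglyMeasurable q
    _ ≤ _ := by
        grw [eLpNorm_le_const_mul_of_discrete q (fun _ => le_rfl),
          eLpNorm_le_const_mul_of_discrete q (fun _ => le_rfl), eLpNorm_count_comp_pred_le U q,
          ← mul_assoc, T_zero]

theorem eLpNorm_blockNorm_invFourier_le_seqLZNorm {q : ℝ≥0∞} (hq : q ≠ 0) {α γ : ℝ}
    (hα : -recip q < α) (hγ : α + recip q ≤ γ) :
    ∃ C : ℝ≥0∞, C ≠ ∞ ∧ ∀ {ι : Type*} {φ : ι → Lp ℂ 2 volI} {M : ℝ} {c : ι → ℂ},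
      Orthonormal ℂ φ → 1 ≤ M → (∀ n, eLpNorm (φ n) ∞ volI ≤ ENNReal.ofReal M) →
      tailNorm (seqDyadic c) 0 ≠ ∞ →
      eLpNorm (fun l : ℕ => (2 : ℝ≥0∞) ^ ((α + recip q) * l) *
          blockNorm (funDyadic (invFourier φ c)) l) q Measure.count ≤
        C * ENNReal.ofReal (min M ((1 + Real.log M) ^ γ)) *
          seqLZNorm 2 q (α + recip (min q 2)) c := by
  set δ := α + recip q
  have δ_pos : 0 < δ := by linarith
  obtain ⟨C₁, hC₁, tail_le⟩ := eLpNorm_tailNorm_seqDyadic_le hq hα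
  obtain ⟨C₂, hC₂, weight_le⟩ := eLpNorm_weighted_exp_tail_le δ_pos hγ hq
  have add_const_ne_top := (ENNReal.LpAddConst_lt_top q).ne
  have two_rpow_abs_ne_top := two_rpow_ne_top |δ|
  have two_rpow_recip_ne_top := two_rpow_ne_top (recip q)
  refine ⟨ENNReal.LpAddConst q * (2 * 2 ^ |δ| * 2 ^ recip q * C₁ + 2 * C₁ * C₂), by finiteness,
    fun {ι φ M c} hφ one_le_M hM hc => ?_⟩
  have one_le_L : 1 ≤ 1 + Real.log M := by linarith [Real.log_nonneg one_le_M]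
  have one_le_bound : 1 ≤ ENNReal.ofReal (min M ((1 + Real.log M) ^ γ)) :=
    ENNReal.one_le_ofReal.2 (le_min one_le_M (Real.one_le_rpow one_le_L (by linarith)))
  have weight_le := weight_le M one_le_M
  generalize ENNReal.ofReal (min M ((1 + Real.log M) ^ γ)) = Λ at one_le_bound weight_le ⊢
  grw [eLpNorm_blockNorm_invFourier_le hφ hM hc δ, tailNorm_seqDyadic_zero_le hq δ c, weight_le,
    tail_le c]
  calc _ = ENNReal.LpAddConst q * (2 * 2 ^ |δ| * 2 ^ recip q * C₁ * 1 + 2 * C₁ * C₂ * Λ) *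
          seqLZNorm 2 q (α + recip (min q 2)) c := by ring
    _ ≤ ENNReal.LpAddConst q * (2 * 2 ^ |δ| * 2 ^ recip q * C₁ * Λ + 2 * C₁ * C₂ * Λ) *
          seqLZNorm 2 q (α + recip (min q 2)) c := by gcongr
    _ = _ := by ring

theorem corollary4p2_general {q : ℝ≥0∞} {α γ : ℝ} (hq : 0 < q) (hα : -recip q < α)
    (hγ : α + recip q ≤ γ) :
    ∃ C : ℝ, 0 < C ∧
      ∀ (ι : Type*) [Nonempty ι] (φ : ι → Lp ℂ 2 volI) (M : ℝ),
        Orthonormal ℂ φ →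
        (∀ n, eLpNorm (φ n) ∞ volI ≤ ENNReal.ofReal M) →
        ∀ c ∈ seqLZ ι 2 q (α + recip (min q 2)),
          Summable (fun n => c n • φ n) ∧
          (invFourier φ c : ℝ → ℂ) ∈
            funLZ 2 q (α + recip (max q 2)) ∩ funLZ 2 (max q 2) (α + recip q) ∧
          max (funLZNorm 2 q (α + recip (max q 2)) (invFourier φ c))
              (funLZNorm 2 (max q 2) (α + recip q) (invFourier φ c)) ≤
            ENNReal.ofReal (C * min M ((1 + Real.log M) ^ γ)) *
              seqLZNorm 2 q (α + recip (min q 2)) c := by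
  obtain ⟨C₁, hC₁, tail_le⟩ := eLpNorm_tailNorm_seqDyadic_le hq.ne' hα
  obtain ⟨C₂, hC₂, block_le⟩ := eLpNorm_blockNorm_invFourier_le_seqLZNorm hq.ne' hα hγ
  obtain ⟨C₃, hC₃, norm_le⟩ := max_funLZNorm_le_eLpNorm_blockNorm hq.ne' α
  refine ⟨(C₃ * C₂).toReal + 1, by positivity, fun ι _ φ M hφ hM c hc => ?_⟩
  have one_le_M : 1 ≤ M := ENNReal.one_le_ofReal.1 (one_le_of_orthonormal hφ hM)
  have seq_ne_top : seqLZNorm 2 q (α + recip (min q 2)) c ≠ ∞ := ne_of_lt hc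
  have tail_ne_top : tailNorm (seqDyadic c) 0 ≠ ∞ :=
    ne_top_of_le_ne_top (ENNReal.mul_ne_top hC₁ seq_ne_top)
      ((tailNorm_seqDyadic_zero_le hq.ne' _ c).trans (tail_le c))
  have const_le : C₃ * C₂ ≤ ENNReal.ofReal ((C₃ * C₂).toReal + 1) := by
    grw [← (by linarith : (C₃ * C₂).toReal ≤ (C₃ * C₂).toReal + 1),
      ENNReal.ofReal_toReal (ENNReal.mul_ne_top hC₃ hC₂)]
  have bound := (norm_le _).trans (mul_le_mul_right (block_le hφ one_le_M hM tail_ne_top) _)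
  rw [← mul_assoc, ← mul_assoc] at bound
  grw [const_le, ← ENNReal.ofReal_mul (by positivity)] at bound
  have finite := bound.trans_lt (ENNReal.mul_lt_top ENNReal.ofReal_lt_top seq_ne_top.lt_top)
  exact ⟨summable_of_tailNorm_seqDyadic_ne_top hφ tail_ne_top,
    ⟨⟨Lp.aestronglyMeasurable _, (le_max_left _ _).trans_lt finite⟩,
      ⟨Lp.aestronglyMeasurable _, (le_max_right _ _).trans_lt finite⟩⟩, bound⟩

theorem corollary4p2 :
    (∀ (q : ℝ≥0∞) (α ε : ℝ), 0 < q → -recip q < α → 0 < ε →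
      ∃ C : ℝ, 0 < C ∧
        ∀ (ι : Type) [Countable ι] [Infinite ι] (φ : ι → Lp ℂ 2 volI) (M : ℝ),
          Orthonormal ℂ φ →
          (⨆ n, eLpNorm (φ n) ∞ volI) = ENNReal.ofReal M →
          ∀ c ∈ seqLZ ι 2 q (α + recip (min q 2)),
            Summable (fun n => c n • φ n) ∧
            (invFourier φ c : ℝ → ℂ) ∈
              funLZ 2 q (α + recip (max q 2)) ∩ funLZ 2 (max q 2) (α + recip q) ∧
            max (funLZNorm 2 q (α + recip (max q 2)) (invFourier φ c))
                (funLZNorm 2 (max q 2) (α + recip q) (invFourier φ c)) ≤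
              ENNReal.ofReal (C * min M ((1 + Real.log M) ^ |α + ε + recip q|)) *
                seqLZNorm 2 q (α + recip (min q 2)) c) ∧
    (∀ α ε : ℝ, -(1 / 2) < α → 0 < ε →
      ∃ C : ℝ, 0 < C ∧
        ∀ (ι : Type) [Countable ι] [Infinite ι] (φ : ι → Lp ℂ 2 volI) (M : ℝ),
          Orthonormal ℂ φ →
          (⨆ n, eLpNorm (φ n) ∞ volI) = ENNReal.ofReal M →
          ∀ c ∈ seqLZ ι 2 2 (α + 1 / 2),
            Summable (fun n => c n • φ n) ∧
            (invFourier φ c : ℝ → ℂ) ∈ funLZ 2 2 (α + 1 / 2) ∧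
            funLZNorm 2 2 (α + 1 / 2) (invFourier φ c) ≤
              ENNReal.ofReal (C * min M ((1 + Real.log M) ^ |α + ε + 1 / 2|)) *
                seqLZNorm 2 2 (α + 1 / 2) c) := by
  refine (and_iff_left_of_imp fun h α ε hα hε => ?_).2 fun q α ε hq hα hε => ?_
  · simpa only [min_self, max_self, recip_two, inter_self] using
      h 2 α ε two_pos (recip_two.symm ▸ hα) hε
  · obtain ⟨C, hC, h⟩ := corollary4p2_general hq hα
      (show α + recip q ≤ |α + ε + recip q| from le_trans (by linarith) (le_abs_self _))
    exact ⟨C, hC, fun ι _ _ φ M hφ hM => h ι φ M hφ fun n => (le_iSup _ n).trans_eq hM⟩
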